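/- Let $R$ be a commutative ring with $1$, $I$ an ideal of $R$, and $n\ge 3$. Let $\mathrm{Um}_n(R)$ be the set of unimodular rows of length $n$ (rows $v$ with $v\cdot w^t=1$ for some $w\in R^n$), and $\mathrm{Um}_n(R,I)\subseteq \mathrm{Um}_n(R)$ the set of those congruent to $e_1=(1,0,\dots,0)$ modulo $I$. Let $\mathrm{E}_n(R)\subseteq\mathrm{GL}_n(R)$ be the subgroup generated by the elementary matrices $E_{ij}(c)=I_n+c\,e_{ij}$ ($i\ne j$, $c\in R$), $\mathrm{E}_n(R,I)$ the smallest normal subgroup of $\mathrm{E}_n(R)$ containing all $E_{21}(x)$, $x\in I$, and $\mathrm{MSE}_n(R)=\mathrm{Um}_n(R)/\mathrm{E}_n(R)$, $\mathrm{MSE}_n(R,I)=\mathrm{Um}_n(R,I)/\mathrm{E}_n(R,I)$ the sets of orbits. For $S=R$ or $S=\mathbb Z$ let $S\oplus I$ be the excision ring, with coordinatewise addition and $(s,i)(t,j)=(st,\,sj+ti+ij)$. A group operation $*$ on $\mathrm{MSE}_n(R)$ is given by the Vaserstein--van der Kallen rule if for all $v=(a,a_2,\dots,a_n)$ and $w=(b,a_2,\dots,a_n)$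 in $\mathrm{Um}_n(R)$ and all $p\in R$ with $ap\equiv 1 \pmod{(a_2,\dots,a_n)}$, $$[w]*[v]=[(a(b+p)-1,\ a_2(b+p),\ a_3,\dots,a_n)];$$ it is then nice if for all such $v,w$ $$[(b,a_2,\dots,a_n)]*[(a,a_2,\dots,a_n)]=[(ab,a_2,\dots,a_n)].$$ A group operation on $\mathrm{MSE}_n(R,I)$ is given by the Vaserstein--van der Kallen rule if the operation it induces on $\mathrm{MSE}_n(\mathbb Z\oplus I)$, through the natural bijections $F:\mathrm{MSE}_n(\mathbb Z\oplus I,0\oplus I)\to\mathrm{MSE}_n(R,I)$, induced by $(m,i)\mapsto m+i$, and $G:\mathrm{MSE}_n(\mathbb Z\oplus I,0\oplus I)\to\mathrm{MSE}_n(\mathbb Z\oplus I)$, $[v]\mapsto[v]$, is given by that rule. It is then nice if for every $i\in\{1,\dots,n\}$ and all rows in $\mathrm{Um}_n(R,I)$ that agree outside the $i$-th coordinate, $$[(a_1,\dots,a_{i-1},b,a_{i+1},\dots,a_n)]*[(a_1,\dots,a_{i-1},a,a_{i+1},\dots,a_n)]=[(a_1,\dots,a_{i-1},ab,a_{i+1},\dots,a_n)].$$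 Suppose that $\mathrm{MSE}_n(R,I)$ and $\mathrm{MSE}_n(R\oplus I)$ both carry group structures given by the Vaserstein--van der Kallen rule. If the group structure on $\mathrm{MSE}_n(R\oplus I)$ is nice, then the group structure on $\mathrm{MSE}_n(R,I)$ is nice. -/

import Mathlib

open Matrix

/-- A row is unimodular if some row pairs with it to `1`. -/
def IsUnimodular {n : ℕ} {R : Type*} [CommRing R] (v : Fin n → R) : Prop :=
  ∃ w : Fin n → R, v ⬝ᵥ w = 1

/-- `Um_n(R)`, the unimodular rows of length `n`. -/
abbrev Um (n : ℕ) (R : Type*) [CommRing R] : Type _ :=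
  {v : Fin n → R // IsUnimodular v}

/-- `Um_n(R, I)`, the unimodular rows congruent to `e₁ = (1, 0, …, 0)` modulo `I`. -/
abbrev UmRel (n : ℕ) [NeZero n] (R : Type*) [CommRing R] (I : Ideal R) : Type _ :=
  {v : Fin n → R // IsUnimodular v ∧ v 0 - 1 ∈ I ∧ ∀ j, j ≠ 0 → v j ∈ I}

/-- `E_n(R)`: the subgroup of `GL_n(R)` generated by the elementary matrices `1 + c e_{ij}`. -/
def elemGroup (n : ℕ) (R : Type*) [CommRing R] : Subgroup (GL (Fin n) R) :=
  Subgroup.closure {g | ∃ i j : Fin n, i ≠ j ∧ ∃ c : R,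
    (g : Matrix (Fin n) (Fin n) R) = Matrix.transvection i j c}

/-- `E_n(R, I)`: the smallest normal subgroup of `E_n(R)` containing the matrices `E_{21}(x)`,
`x ∈ I`, viewed as a subgroup of `GL_n(R)`. Indices start at `0`. -/
def elemGroupRel (n : ℕ) [NeZero n] (R : Type*) [CommRing R] (I : Ideal R) :
    Subgroup (GL (Fin n) R) :=
  (Subgroup.normalClosure {g : elemGroup n R | ∃ x ∈ I,
    ((g : GL (Fin n) R) : Matrix (Fin n) (Fin n) R) = Matrix.transvection 1 0 x}).map
      (elemGroup n R).subtype

/-- The orbit relation of a subgroup `H` of `GL_n(R)`, acting on row vectors from the right,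
restricted to a set of rows. -/
def rowSetoid {n : ℕ} {R : Type*} [CommRing R] (H : Subgroup (GL (Fin n) R))
    (P : (Fin n → R) → Prop) : Setoid {v : Fin n → R // P v} where
  r v w := ∃ g ∈ H, (v : Fin n → R) ᵥ* (g : Matrix (Fin n) (Fin n) R) = w
  iseqv :=
    { refl := fun v => ⟨1, H.one_mem, by simp⟩
      symm := by
        rintro v w ⟨g, hg, h⟩
        refine ⟨g⁻¹, H.inv_mem hg, ?_⟩
        rw [← h, Matrix.vecMul_vecMul, ← Units.val_mul, mul_inv_cancel]
        simp
      trans := by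
        rintro u v w ⟨g, hg, h⟩ ⟨k, hk, h'⟩
        refine ⟨g * k, H.mul_mem hg hk, ?_⟩
        rw [Units.val_mul, ← Matrix.vecMul_vecMul, h, h'] }

/-- `MSE_n(R) = Um_n(R) / E_n(R)`. -/
def MSE (n : ℕ) (R : Type*) [CommRing R] : Type _ :=
  Quotient (rowSetoid (elemGroup n R) (fun v => IsUnimodular v))

/-- The class of a unimodular row in `MSE_n(R)`. -/
def MSE.mk {n : ℕ} {R : Type*} [CommRing R] (v : Um n R) : MSE n R :=
  Quotient.mk _ v

/-- `MSE_n(R, I) = Um_n(R, I) / E_n(R, I)`. -/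
def MSERel (n : ℕ) [NeZero n] (R : Type*) [CommRing R] (I : Ideal R) : Type _ :=
  Quotient (rowSetoid (elemGroupRel n R I)
    (fun v => IsUnimodular v ∧ v 0 - 1 ∈ I ∧ ∀ j, j ≠ 0 → v j ∈ I))

/-- The class of a relative unimodular row in `MSE_n(R, I)`. -/
def MSERel.mk {n : ℕ} [NeZero n] {R : Type*} [CommRing R] {I : Ideal R} (v : UmRel n R I) :
    MSERel n R I :=
  Quotient.mk _ v

section functoriality

variable {n : ℕ} {A B : Type*} [CommRing A] [CommRing B]

theorem IsUnimodular.map (f : A →+* B) {v : Fin n → A} (hv : IsUnimodular v) :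
    IsUnimodular (fun j => f (v j)) := by
  obtain ⟨w, hw⟩ := hv
  exact ⟨fun j => f (w j), by simpa [dotProduct] using congrArg f hw⟩

theorem map_transvection_val (f : A →+* B) (i j : Fin n) (c : A) :
    (Matrix.transvection i j c).map f = Matrix.transvection i j (f c) := by
  ext k l
  simp only [Matrix.transvection, Matrix.map_apply, Matrix.add_apply, Matrix.single_apply,
    Matrix.one_apply, map_add]
  split_ifs <;> simp

theorem elemGroup_map (f : A →+* B) {g : GL (Fin n) A} (hg : g ∈ elemGroup n A) :
    Matrix.GeneralLinearGroup.map f g ∈ elemGroup n B := by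
  have h : elemGroup n A ≤ (elemGroup n B).comap (Matrix.GeneralLinearGroup.map f) := by
    refine (Subgroup.closure_le _).2 ?_
    rintro g ⟨i, j, hij, c, hc⟩
    refine Subgroup.subset_closure ⟨i, j, hij, f c, ?_⟩
    rw [← map_transvection_val, ← hc]
    rfl
  exact h hg

theorem elemGroupRel_map [NeZero n] (f : A →+* B) {I : Ideal A} {J : Ideal B}
    (hf : ∀ x ∈ I, f x ∈ J) {g : GL (Fin n) A} (hg : g ∈ elemGroupRel n A I) :
    Matrix.GeneralLinearGroup.map f g ∈ elemGroupRel n B J := by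
  let φ : elemGroup n A →* elemGroup n B :=
    ((Matrix.GeneralLinearGroup.map f).comp (elemGroup n A).subtype).codRestrict (elemGroup n B)
      (fun g => elemGroup_map f g.2)
  obtain ⟨g, hg, rfl⟩ := hg
  refine ⟨φ g, ?_, rfl⟩
  have h : Subgroup.normalClosure {g : elemGroup n A | ∃ x ∈ I,
      ((g : GL (Fin n) A) : Matrix (Fin n) (Fin n) A) = Matrix.transvection 1 0 x} ≤
      (Subgroup.normalClosure {g : elemGroup n B | ∃ x ∈ J,
      ((g : GL (Fin n) B) : Matrix (Fin n) (Fin n) B) = Matrix.transvection 1 0 x}).comap φ := by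
    refine Subgroup.normalClosure_le_normal ?_
    rintro g ⟨x, hx, h⟩
    refine Subgroup.subset_normalClosure ⟨f x, hf x hx, ?_⟩
    rw [← map_transvection_val, ← h]
    rfl
  exact h hg

/-- The map `MSE_n(A, I) → MSE_n(B, J)` induced by a ring homomorphism `f` with `f(I) ⊆ J`:
`[(a_i)] ↦ [(f(a_i))]`. -/
def MSERel.map [NeZero n] (f : A →+* B) {I : Ideal A} {J : Ideal B} (hf : ∀ x ∈ I, f x ∈ J) :
    MSERel n A I → MSERel n B J :=
  Quotient.map
    (fun v => ⟨fun j => f (v.1 j), v.2.1.map f, by simpa using hf _ v.2.2.1,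
      fun j hj => hf _ (v.2.2.2 j hj)⟩)
    (by
      rintro v w ⟨g, hg, h⟩
      refine ⟨Matrix.GeneralLinearGroup.map f g, elemGroupRel_map f hf hg, ?_⟩
      funext j
      have hj : f (((v : Fin n → A) ᵥ* (g : Matrix (Fin n) (Fin n) A)) j) = f (w.1 j) := by
        rw [h]
      simpa [Matrix.vecMul, dotProduct] using hj)

/-- The map `MSE_n(A, I) → MSE_n(A)`, `[v] ↦ [v]`. -/
def MSERel.toMSE [NeZero n] {I : Ideal A} : MSERel n A I → MSE n A :=
  Quotient.map (fun v => ⟨v.1, v.2.1⟩)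
    (by
      rintro v w ⟨g, ⟨k, -, rfl⟩, h⟩
      exact ⟨k, k.2, h⟩)

end functoriality

section excision

variable {R : Type*} [CommRing R]

/-- The excision ring `R ⊕ I`. Mathlib's unitization carries coordinatewise addition, the product
`(r, i) (s, j) = (r s, r j + s i + i j)` and the unit `(1, 0)`. -/
abbrev ExcisionRing (I : Ideal R) : Type _ := Unitization R I

/-- The excision ring `ℤ ⊕ I`, with the product `(m, i) (n, j) = (m n, m j + n i + i j)`. -/
abbrev IntExcisionRing (I : Ideal R) : Type _ := Unitization ℤ I

/-- The ideal `0 ⊕ I` of `ℤ ⊕ I`. -/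
def IntExcisionRing.ideal (I : Ideal R) : Ideal (IntExcisionRing I) :=
  RingHom.ker (Unitization.fstHom ℤ I)

/-- The ring homomorphism `f : ℤ ⊕ I → R`, `f (m, i) = m + i`. -/
def IntExcisionRing.toRing (I : Ideal R) : IntExcisionRing I →+* R where
  toFun x := (x.fst : R) + (x.snd : R)
  map_one' := by simp
  map_zero' := by simp
  map_add' x y := by
    simp only [Unitization.fst_add, Unitization.snd_add, Submodule.coe_add]
    push_cast
    ring
  map_mul' x y := by
    simp
    ring

theorem IntExcisionRing.toRing_mem (I : Ideal R) :
    ∀ x ∈ IntExcisionRing.ideal I, IntExcisionRing.toRing I x ∈ I := by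
  intro x hx
  have h : x.fst = 0 := hx
  simp [IntExcisionRing.toRing, h]

/-- `F : MSE_n(ℤ ⊕ I, 0 ⊕ I) → MSE_n(R, I)`, `[(a_i)] ↦ [(f(a_i))]`. -/
def excisionF (n : ℕ) [NeZero n] (I : Ideal R) :
    MSERel n (IntExcisionRing I) (IntExcisionRing.ideal I) → MSERel n R I :=
  MSERel.map (IntExcisionRing.toRing I) (IntExcisionRing.toRing_mem I)

/-- `G : MSE_n(ℤ ⊕ I, 0 ⊕ I) → MSE_n(ℤ ⊕ I)`, `[(a_i)] ↦ [(a_i)]`. -/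
def excisionG (n : ℕ) [NeZero n] (I : Ideal R) :
    MSERel n (IntExcisionRing I) (IntExcisionRing.ideal I) → MSE n (IntExcisionRing I) :=
  MSERel.toMSE

end excision

section rules

variable {n : ℕ} [NeZero n] {R : Type*} [CommRing R]

/-- The row `(a (b + p) - 1, a₂ (b + p), a₃, …, a_n)` for `v = (a, a₂, …, a_n)`. -/
def vvRow (v : Fin n → R) (b p : R) : Fin n → R := fun j =>
  if j = 0 then v 0 * (b + p) - 1 else if j = 1 then v 1 * (b + p) else v j

/-- An operation on `MSE_n(R)` is given by the Vaserstein–van der Kallen rule: if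
`v = (a, a₂, …, a_n)` and `w = (b, a₂, …, a_n)` are unimodular and
`a p ≡ 1` modulo `(a₂, …, a_n)`, then `[w] * [v] = [(a (b + p) - 1, a₂ (b + p), a₃, …, a_n)]`.
(The row on the right is always unimodular.) -/
def IsVvRule (op : MSE n R → MSE n R → MSE n R) : Prop :=
  ∀ v w : Um n R, (∀ j, j ≠ 0 → w.1 j = v.1 j) →
    ∀ p : R, v.1 0 * p - 1 ∈ Ideal.span {x | ∃ j, j ≠ 0 ∧ x = v.1 j} →
      ∃ h : IsUnimodular (vvRow v.1 (w.1 0) p),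
        op (MSE.mk w) (MSE.mk v) = MSE.mk ⟨vvRow v.1 (w.1 0) p, h⟩

/-- `op'` is the operation on `MSE_n(ℤ ⊕ I)` induced by the operation `op` on `MSE_n(R, I)` through
`F` and `G`. -/
def IsInducedOp {I : Ideal R} (op : MSERel n R I → MSERel n R I → MSERel n R I)
    (op' : MSE n (IntExcisionRing I) → MSE n (IntExcisionRing I) → MSE n (IntExcisionRing I)) :
    Prop :=
  ∀ x y z : MSERel n (IntExcisionRing I) (IntExcisionRing.ideal I),
    excisionF n I z = op (excisionF n I x) (excisionF n I y) →
      op' (excisionG n I x) (excisionG n I y) = excisionG n I z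

/-- An operation on `MSE_n(R, I)` is given by the Vaserstein–van der Kallen rule if the operation
it induces on `MSE_n(ℤ ⊕ I)` is. -/
def IsVvRuleRel {I : Ideal R} (op : MSERel n R I → MSERel n R I → MSERel n R I) : Prop :=
  ∃ op' : MSE n (IntExcisionRing I) → MSE n (IntExcisionRing I) → MSE n (IntExcisionRing I),
    IsInducedOp op op' ∧ IsVvRule op'

/-- Niceness of an operation on `MSE_n(R)`:
`[(b, a₂, …, a_n)] * [(a, a₂, …, a_n)] = [(a b, a₂, …, a_n)]`. -/
def IsNice (op : MSE n R → MSE n R → MSE n R) : Prop :=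
  ∀ v w : Um n R, (∀ j, j ≠ 0 → w.1 j = v.1 j) →
    ∃ h : IsUnimodular (Function.update v.1 0 (v.1 0 * w.1 0)),
      op (MSE.mk w) (MSE.mk v) = MSE.mk ⟨Function.update v.1 0 (v.1 0 * w.1 0), h⟩

/-- Niceness of an operation on `MSE_n(R, I)`: for every coordinate `i`,
`[(a₁, …, b, …, a_n)] * [(a₁, …, a, …, a_n)] = [(a₁, …, a b, …, a_n)]`, where `b`, `a`, `a b` are
the `i`-th entries. For the operations given by the Vaserstein–van der Kallen rule it is equivalent
to ask this for the first coordinate only, or for the last only; here all are required. -/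
def IsNiceRel {I : Ideal R} (op : MSERel n R I → MSERel n R I → MSERel n R I) : Prop :=
  ∀ (i : Fin n) (v w : UmRel n R I), (∀ j, j ≠ i → w.1 j = v.1 j) →
    ∃ u : UmRel n R I, u.1 = Function.update v.1 i (v.1 i * w.1 i) ∧
      op (MSERel.mk w) (MSERel.mk v) = MSERel.mk u

end rules

/-! Lifting a row congruent to e₁ modulo I to the row over R ⊕ I congruent to e₁ modulo 0 ⊕ I gives
a map φ : MSE_n(R, I) → MSE_n(R ⊕ I), `MSERel.toExcision`. Were φ an injective homomorphism,
niceness would pull back at once. The proof gets by with two weaker facts.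

(a) φ has trivial kernel (`MSERel.eq_base_of_toExcision_eq`). If g ∈ E_n(R ⊕ I) carries a lifted row
to e₁, the image of g in E_n(R) fixes e₁; dividing g by that image leaves an element of E_n(R ⊕ I, 0
⊕ I), which (r, i) ↦ r + i sends to E_n(R, I). For two arbitrary lifted rows the correction could
move the target row.

(b) φ respects products of rows with common tails (`MSERel.exists_mk_mul_mk`), since the same
formula gives both products. On the relative side the formula is known only up to E_n(ℤ ⊕ I). It
descends to R because the stabilizer of e₁ in E_n(ℤ) is generated by the E_{ij}(c) with i ≠ 0,
indices starting at 0 (`mem_lower_of_fixes`), and such matrices do not change relative classes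
(`IsRelRow.rowEquiv_vecMul_lower`). `exists_common_tail` extends (b) to certain rows differing in
two coordinates.

Let u be the row with the product entry and r a row representing [w] * [v]. Niceness over R ⊕ I
gives φ[r] = φ[u]. Inverting one entry of u modulo the others gives c with [c] * [u] = 1. If φ
respects [c] * [r], then φ([c] * [r]) = φ[c] * φ[u] = 1, so [c] * [r] = 1 by (a), and cancellation
gives [r] = [u]. -/

/-! ### Elementary matrices and their action on rows -/

section Transvections

variable {n : ℕ} {R : Type*} [CommRing R]

/-- The elementary matrix `E_{ij}(c)` as an element of `GL_n(R)`. -/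
def elemGL (i j : Fin n) (h : i ≠ j) (c : R) : GL (Fin n) R where
  val := transvection i j c
  inv := transvection i j (-c)
  val_inv := by rw [transvection_mul_transvection_same _ _ h]; simp
  inv_val := by rw [transvection_mul_transvection_same _ _ h]; simp

theorem elemGL_val {i j : Fin n} (h : i ≠ j) (c : R) :
    (elemGL i j h c : Matrix (Fin n) (Fin n) R) = transvection i j c := rfl

theorem elemGL_inv {i j : Fin n} (h : i ≠ j) (c : R) : (elemGL i j h c)⁻¹ = elemGL i j h (-c) :=
  Units.ext rfl

theorem elemGL_zero {i j : Fin n} (h : i ≠ j) : elemGL i j h (0 : R) = 1 :=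
  Units.ext (transvection_zero _ _)

theorem elemGL_mul {i j : Fin n} (h : i ≠ j) (c d : R) :
    elemGL i j h c * elemGL i j h d = elemGL i j h (c + d) :=
  Units.ext (transvection_mul_transvection_same _ _ h c d)

theorem elemGL_commutator {i j k : Fin n} (hij : i ≠ j) (hjk : j ≠ k) (hik : i ≠ k) (c d : R) :
    elemGL i j hij c * elemGL j k hjk d * elemGL i j hij (-c) * elemGL j k hjk (-d)
      = elemGL i k hik (c * d) := by
  apply Units.ext
  simp only [Units.val_mul, elemGL_val, transvection, add_mul, mul_add, one_mul, mul_one,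
    single_mul_single_same]
  simp only [ne_eq, hij.symm, hjk.symm, hik.symm, not_false_eq_true, single_mul_single_of_ne,
    add_zero, zero_mul]
  simp only [mul_neg, neg_mul, neg_neg, ← single_neg]
  abel

theorem vecMul_elemGL {i j : Fin n} (h : i ≠ j) (c : R) (v : Fin n → R) :
    v ᵥ* (elemGL i j h c : Matrix (Fin n) (Fin n) R) = Function.update v j (v j + c * v i) := by
  rw [elemGL_val, transvection, vecMul_add, vecMul_one]
  ext k
  by_cases hk : k = j
  · subst hk
    simp [vecMul, dotProduct, single_apply, mul_comm]
  · simp [vecMul, dotProduct, hk, Ne.symm hk]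

theorem elemGL_mem {i j : Fin n} (h : i ≠ j) (c : R) : elemGL i j h c ∈ elemGroup n R :=
  Subgroup.subset_closure ⟨i, j, h, c, rfl⟩

theorem map_elemGL {S : Type*} [CommRing S] (f : R →+* S) {i j : Fin n} (h : i ≠ j) (c : R) :
    Matrix.GeneralLinearGroup.map f (elemGL i j h c) = elemGL i j h (f c) :=
  Units.ext (map_transvection_val f i j c)

theorem elemGroup_eq_closure : elemGroup n R =
    Subgroup.closure {g | ∃ (i j : Fin n) (h : i ≠ j) (c : R), g = elemGL i j h c} := by
  unfold elemGroup
  congr 1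
  ext g
  constructor
  · rintro ⟨i, j, h, c, hc⟩
    exact ⟨i, j, h, c, Units.ext hc⟩
  · rintro ⟨i, j, h, c, rfl⟩
    exact ⟨i, j, h, c, rfl⟩

theorem det_of_mem_elemGroup {g : GL (Fin n) R} (hg : g ∈ elemGroup n R) :
    (g : Matrix (Fin n) (Fin n) R).det = 1 := by
  rw [elemGroup_eq_closure] at hg
  induction hg using Subgroup.closure_induction with
  | mem g hg =>
    obtain ⟨i, j, h, c, rfl⟩ := hg
    exact det_transvection_of_ne _ _ h c
  | one => simp
  | mul g k _ _ hg hk => simp [hg, hk]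
  | inv g _ hg =>
    have h : (g : Matrix (Fin n) (Fin n) R).det *
        ((g⁻¹ : GL (Fin n) R) : Matrix (Fin n) (Fin n) R).det = 1 := by
      rw [← det_mul, ← Units.val_mul, mul_inv_cancel]; simp
    rwa [hg, one_mul] at h

theorem IsUnimodular.vecMul {v : Fin n → R} (hv : IsUnimodular v) (g : GL (Fin n) R) :
    IsUnimodular (v ᵥ* (g : Matrix (Fin n) (Fin n) R)) := by
  obtain ⟨w, hw⟩ := hv
  refine ⟨((g⁻¹ : GL (Fin n) R) : Matrix (Fin n) (Fin n) R) *ᵥ w, ?_⟩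
  rw [dotProduct_mulVec, vecMul_vecMul, ← Units.val_mul, mul_inv_cancel]
  simpa using hw

theorem vecMul_map {S : Type*} [CommRing S] (f : R →+* S) (v : Fin n → R) (g : GL (Fin n) R) :
    (fun j => f ((v ᵥ* (g : Matrix (Fin n) (Fin n) R)) j)) =
      (fun j => f (v j)) ᵥ* (Matrix.GeneralLinearGroup.map f g : Matrix (Fin n) (Fin n) S) := by
  funext j
  simp [Matrix.vecMul, dotProduct]

theorem MSE.mk_eq_iff {v w : Um n R} :
    MSE.mk v = MSE.mk w ↔
      ∃ g ∈ elemGroup n R, v.1 ᵥ* (g : Matrix (Fin n) (Fin n) R) = w.1 := Quotient.eq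

end Transvections

theorem exists_ne_ne {n : ℕ} (hn : 3 ≤ n) (i j : Fin n) : ∃ k : Fin n, k ≠ i ∧ k ≠ j := by
  obtain ⟨k, -, hk⟩ := Finset.exists_mem_notMem_of_card_lt_card
    (s := ({i, j} : Finset (Fin n))) (t := Finset.univ)
    (lt_of_le_of_lt Finset.card_le_two (by simp; omega))
  simp at hk
  exact ⟨k, hk.1, hk.2⟩

/-! ### Relative elementary groups -/

section Relative

variable {n : ℕ} [NeZero n] {R : Type*} [CommRing R] {I : Ideal R}

theorem elemGroupRel_le : elemGroupRel n R I ≤ elemGroup n R := by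
  rintro g ⟨k, -, rfl⟩
  exact k.2

theorem conj_mem_elemGroupRel {g h : GL (Fin n) R} (hg : g ∈ elemGroupRel n R I)
    (hh : h ∈ elemGroup n R) : h * g * h⁻¹ ∈ elemGroupRel n R I := by
  obtain ⟨k, hk, rfl⟩ := hg
  refine ⟨⟨h, hh⟩ * k * ⟨h, hh⟩⁻¹, Subgroup.normalClosure_normal.conj_mem k hk _, ?_⟩
  rw [map_mul, map_mul, map_inv]
  rfl

theorem commutator_mem_elemGroupRel {g h : GL (Fin n) R} (hg : g ∈ elemGroupRel n R I)
    (hh : h ∈ elemGroup n R) : g * h * g⁻¹ * h⁻¹ ∈ elemGroupRel n R I := by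
  have := (elemGroupRel n R I).mul_mem hg
    (conj_mem_elemGroupRel ((elemGroupRel n R I).inv_mem hg) hh)
  simpa [mul_assoc] using this

theorem commutator_mem_elemGroupRel_left {g h : GL (Fin n) R} (hg : g ∈ elemGroupRel n R I)
    (hh : h ∈ elemGroup n R) : h * g * h⁻¹ * g⁻¹ ∈ elemGroupRel n R I :=
  (elemGroupRel n R I).mul_mem (conj_mem_elemGroupRel hg hh) ((elemGroupRel n R I).inv_mem hg)

theorem one_ne_zero_fin (hn : 3 ≤ n) : (1 : Fin n) ≠ 0 := by
  intro h
  have := congrArg Fin.val h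
  rw [Fin.val_one'] at this
  simp [Nat.mod_eq_of_lt (show 1 < n by omega)] at this

/-- Commutators with matrices E_{jk}(1) carry x from the generating position to another column of
its row or another row of its column; a third index makes every position reachable. -/
theorem elemGL_mem_rel (hn : 3 ≤ n) {i j : Fin n} (h : i ≠ j) {x : R} (hx : x ∈ I) :
    elemGL i j h x ∈ elemGroupRel n R I := by
  have h10 := one_ne_zero_fin hn
  have base : elemGL 1 0 h10 x ∈ elemGroupRel n R I :=
    ⟨⟨_, elemGL_mem h10 x⟩, Subgroup.subset_normalClosure ⟨x, hx, rfl⟩, rfl⟩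
  have right : ∀ {i j k : Fin n} (hij : i ≠ j) (hjk : j ≠ k) (hik : i ≠ k),
      elemGL i j hij x ∈ elemGroupRel n R I → elemGL i k hik x ∈ elemGroupRel n R I := by
    intro i j k hij hjk hik hm
    have := commutator_mem_elemGroupRel hm (elemGL_mem hjk (1 : R))
    rwa [elemGL_inv, elemGL_inv, elemGL_commutator hij hjk hik, mul_one] at this
  have left : ∀ {i j k : Fin n} (hij : i ≠ j) (hjk : j ≠ k) (hik : i ≠ k),
      elemGL j k hjk x ∈ elemGroupRel n R I → elemGL i k hik x ∈ elemGroupRel n R I := by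
    intro i j k hij hjk hik hm
    have := commutator_mem_elemGroupRel_left hm (elemGL_mem hij (1 : R))
    rwa [elemGL_inv, elemGL_inv, elemGL_commutator hij hjk hik, one_mul] at this
  have row1 : ∀ {j : Fin n} (h : 1 ≠ j), elemGL 1 j h x ∈ elemGroupRel n R I := by
    intro j h
    by_cases hj : j = 0
    · subst hj; exact base
    · exact right h10 (Ne.symm hj) h base
  have notcol1 : ∀ {i j : Fin n} (h : i ≠ j), j ≠ 1 → elemGL i j h x ∈ elemGroupRel n R I := by
    intro i j h hj
    by_cases hi : i = 1
    · subst hi; exact row1 h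
    · exact left hi (Ne.symm hj) h (row1 _)
  by_cases hj : j = 1
  · subst hj
    obtain ⟨k, hk1, hk2⟩ := exists_ne_ne hn i 1
    exact right (Ne.symm hk1) hk2 h (notcol1 _ hk2)
  · exact notcol1 h hj

/-- For a split surjection with kernel `J`, an elementary matrix agrees with the lift of its image
up to `E_n(T, J)`. -/
theorem mul_inv_section_mem {S T : Type*} [CommRing S] [CommRing T] (hn : 3 ≤ n) (π : T →+* S)
    (ι : S →+* T) (hπ : ∀ s, π (ι s) = s) {J : Ideal T} (hJ : ∀ x, π x = 0 → x ∈ J)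
    {g : GL (Fin n) T} (hg : g ∈ elemGroup n T) :
    g * (GeneralLinearGroup.map ι (GeneralLinearGroup.map π g))⁻¹ ∈ elemGroupRel n T J := by
  rw [elemGroup_eq_closure] at hg
  induction hg using Subgroup.closure_induction with
  | mem g hg =>
    obtain ⟨i, j, h, c, rfl⟩ := hg
    rw [map_elemGL, map_elemGL, elemGL_inv, elemGL_mul]
    exact elemGL_mem_rel hn h (hJ _ (by simp [hπ]))
  | one => simp [(elemGroupRel n T J).one_mem]
  | mul g k hg _ hg' hk' =>
    rw [← elemGroup_eq_closure] at hg
    have := (elemGroupRel n T J).mul_mem (conj_mem_elemGroupRel hk' hg) hg'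
    simpa [mul_assoc] using this
  | inv g hg hg' =>
    rw [← elemGroup_eq_closure] at hg
    have := conj_mem_elemGroupRel ((elemGroupRel n T J).inv_mem hg')
      ((elemGroup n T).inv_mem hg)
    simpa [mul_assoc] using this

end Relative

/-! ### Stabilizers of basis vectors over ℤ -/

section StabilizerInt

variable {n : ℕ} {R : Type*} [CommRing R]

/-- The subgroup of `GL_n(R)` generated by the elementary matrices `E_{ij}(c)` with `k ≤ i`;
its elements fix the first `k` vectors of the standard basis. -/
def lowerElemGroup (n : ℕ) (R : Type*) [CommRing R] (k : ℕ) : Subgroup (GL (Fin n) R) :=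
  Subgroup.closure {g | ∃ (i j : Fin n) (h : i ≠ j) (c : R), k ≤ i.val ∧ g = elemGL i j h c}

theorem elemGL_mem_lower {k : ℕ} {i j : Fin n} (h : i ≠ j) (hk : k ≤ i.val) (c : R) :
    elemGL i j h c ∈ lowerElemGroup n R k :=
  Subgroup.subset_closure ⟨i, j, h, c, hk, rfl⟩

theorem lowerElemGroup_le (k : ℕ) : lowerElemGroup n R k ≤ elemGroup n R := by
  refine (Subgroup.closure_le _).2 ?_
  rintro g ⟨i, j, h, c, -, rfl⟩
  exact elemGL_mem h c

theorem lowerElemGroup_anti {k l : ℕ} (h : k ≤ l) :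
    lowerElemGroup n R l ≤ lowerElemGroup n R k := by
  refine Subgroup.closure_mono ?_
  rintro g ⟨i, j, hij, c, hi, rfl⟩
  exact ⟨i, j, hij, c, h.trans hi, rfl⟩

theorem map_mem_lowerElemGroup {S : Type*} [CommRing S] (f : R →+* S) {k : ℕ} {g : GL (Fin n) R}
    (hg : g ∈ lowerElemGroup n R k) :
    Matrix.GeneralLinearGroup.map f g ∈ lowerElemGroup n S k := by
  have h : lowerElemGroup n R k ≤ (lowerElemGroup n S k).comap (GeneralLinearGroup.map f) := by
    refine (Subgroup.closure_le _).2 ?_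
    rintro g ⟨i, j, hij, c, hi, rfl⟩
    show GeneralLinearGroup.map f (elemGL i j hij c) ∈ lowerElemGroup n S k
    rw [map_elemGL]
    exact elemGL_mem_lower hij hi _
  exact h hg

theorem vecMul_inv_eq {v : Fin n → R} {g : GL (Fin n) R}
    (h : v ᵥ* (g : Matrix (Fin n) (Fin n) R) = v) :
    v ᵥ* ((g⁻¹ : GL (Fin n) R) : Matrix (Fin n) (Fin n) R) = v := by
  conv_lhs => rw [← h]
  rw [vecMul_vecMul, ← Units.val_mul, mul_inv_cancel]
  simp

theorem single_vecMul_lower {k : ℕ} {g : GL (Fin n) R} (hg : g ∈ lowerElemGroup n R k)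
    {i : Fin n} (hi : i.val < k) :
    Pi.single i 1 ᵥ* (g : Matrix (Fin n) (Fin n) R) = Pi.single i 1 := by
  induction hg using Subgroup.closure_induction with
  | mem g hg =>
    obtain ⟨a, b, h, c, ha, rfl⟩ := hg
    rw [vecMul_elemGL, Pi.single_eq_of_ne (by rintro rfl; omega : a ≠ i)]
    simp
  | one => simp
  | mul g k _ _ hg hk => rw [Units.val_mul, ← vecMul_vecMul, hg, hk]
  | inv g _ hg => exact vecMul_inv_eq hg

/-- An entry equal to `1` clears the other entries of a row. -/
theorem exists_lower_vecMul_eq_single (κ : Fin n) {r : Fin n → R} (hr : r κ = 1) :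
    ∃ g ∈ lowerElemGroup n R κ.val,
      r ᵥ* (g : Matrix (Fin n) (Fin n) R) = Pi.single κ 1 := by
  have key : ∀ s : Finset (Fin n), κ ∉ s → ∃ g ∈ lowerElemGroup n R κ.val,
      r ᵥ* (g : Matrix (Fin n) (Fin n) R) = fun j => if j ∈ s then 0 else r j := by
    intro s
    induction s using Finset.induction_on with
    | empty => exact fun _ => ⟨1, one_mem _, by simp⟩
    | insert a s ha ih =>
      intro hκ
      simp only [Finset.mem_insert, not_or] at hκ
      obtain ⟨g, hg, h⟩ := ih hκ.2
      refine ⟨g * elemGL κ a hκ.1 (-r a), mul_mem hg (elemGL_mem_lower _ le_rfl _), ?_⟩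
      rw [Units.val_mul, ← vecMul_vecMul, h, vecMul_elemGL]
      ext j
      by_cases hj : j = a
      · subst hj; simp [ha, hκ.2, hr]
      · simp [hj]
  obtain ⟨g, hg, h⟩ := key (Finset.univ.erase κ) (by simp)
  refine ⟨g, hg, h.trans ?_⟩
  ext j
  by_cases hj : j = κ
  · subst hj; simp [hr]
  · simp [hj]

/-- Euclid's algorithm on the entries from κ on, whose only common divisors are units: the sum of
their absolute values drops until a single nonzero entry, ±1, is left. -/
theorem exists_lower_vecMul_apply_eq_one (κ : Fin n) (hκ : κ.val + 1 < n) (r : Fin n → ℤ)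
    (hr : ∀ d : ℤ, (∀ i, κ ≤ i → d ∣ r i) → IsUnit d) :
    ∃ g ∈ lowerElemGroup n ℤ κ.val, (r ᵥ* (g : Matrix (Fin n) (Fin n) ℤ)) κ = 1 := by
  induction hN : ∑ i with κ ≤ i, (r i).natAbs using Nat.strong_induction_on generalizing r with
  | _ N ih =>
  by_cases hex : ∃ i j, κ ≤ i ∧ κ ≤ j ∧ i ≠ j ∧ r i ≠ 0 ∧ r j ≠ 0
  · obtain ⟨i, j, hi, hj, hij, hri, hle⟩ : ∃ i j, κ ≤ i ∧ κ ≤ j ∧ i ≠ j ∧ r i ≠ 0 ∧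
        (r i).natAbs ≤ (r j).natAbs := by
      obtain ⟨i, j, hi, hj, hij, hri, hrj⟩ := hex
      rcases le_total (r i).natAbs (r j).natAbs with h | h
      · exact ⟨i, j, hi, hj, hij, hri, h⟩
      · exact ⟨j, i, hj, hi, hij.symm, hrj, h⟩
    obtain ⟨c, hc⟩ : ∃ c : ℤ, (r j + c * r i).natAbs < (r j).natAbs := by
      by_cases h : (r j - r i).natAbs < (r j).natAbs
      · exact ⟨-1, by rwa [neg_one_mul, ← sub_eq_add_neg]⟩
      · exact ⟨1, by rw [one_mul]; omega⟩
    have hlt : ∑ l with κ ≤ l, (Function.update r j (r j + c * r i) l).natAbs < N := by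
      rw [← hN]
      refine Finset.sum_lt_sum (fun l _ => ?_) ⟨j, by simpa using hj, by simpa using hc⟩
      by_cases hl : l = j
      · subst hl; simpa using hc.le
      · simp [hl]
    obtain ⟨g, hg, h⟩ := ih _ hlt (Function.update r j (r j + c * r i)) (by
      intro d hd
      refine hr d fun l hl => ?_
      have hdi : d ∣ r i := by simpa [hij] using hd i hi
      by_cases hlj : l = j
      · subst hlj
        have := hd l hl
        rw [Function.update_self] at this
        exact (dvd_add_left (hdi.mul_left c)).1 this
      · simpa [hlj] using hd l hl) rfl
    refine ⟨elemGL i j hij c * g, mul_mem (elemGL_mem_lower _ hi _) hg, ?_⟩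
    rw [Units.val_mul, ← vecMul_vecMul, vecMul_elemGL, h]
  · push Not at hex
    obtain ⟨i, hi, hri⟩ : ∃ i, κ ≤ i ∧ r i ≠ 0 := by
      by_contra! h
      exact not_isUnit_zero (hr 0 fun i hi => by simp [h i hi])
    have hz : ∀ j, κ ≤ j → j ≠ i → r j = 0 := fun j hj hji => hex i j hi hj hji.symm hri
    have hu : IsUnit (r i) := hr _ fun j hj => by
      by_cases hji : j = i
      · rw [hji]
      · simp [hz j hj hji]
    by_cases hik : i = κ
    · subst hik
      rcases Int.isUnit_iff.1 hu with h | h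
      · exact ⟨1, one_mem _, by simpa using h⟩
      · obtain ⟨j, hj⟩ : ∃ j : Fin n, j.val = i.val + 1 := ⟨⟨_, hκ⟩, rfl⟩
        have hij : i ≠ j := by rintro rfl; omega
        -- The sign is corrected through a neighbouring zero: (-1, 0) ↦ (-1, -1) ↦ (1, -1). This is
        -- where κ + 1 < n is needed.
        refine ⟨elemGL i j hij 1 * elemGL j i hij.symm (-2),
          mul_mem (elemGL_mem_lower _ le_rfl _) (elemGL_mem_lower _ (by omega) _), ?_⟩
        rw [Units.val_mul, ← vecMul_vecMul, vecMul_elemGL, vecMul_elemGL]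
        simp [hij, h, hz j (Fin.le_def.2 (by omega)) hij.symm]
    · refine ⟨elemGL i κ hik (r i), elemGL_mem_lower _ hi _, ?_⟩
      rw [vecMul_elemGL, Function.update_self, hz κ le_rfl (Ne.symm hik)]
      rcases Int.isUnit_iff.1 hu with h | h <;> simp [h]

/-- Descending induction on k. Invertibility of g forces the entries of row k from column k on to be
coprime, so right multiplication by the subgroup of level k turns this row into a basis vector
without disturbing the earlier ones. -/
theorem mem_lower_of_fixes (k : ℕ) (hk : k ≤ n) (g : GL (Fin n) ℤ)
    (hdet : (g : Matrix (Fin n) (Fin n) ℤ).det = 1)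
    (hg : ∀ i : Fin n, i.val < k →
      Pi.single i 1 ᵥ* (g : Matrix (Fin n) (Fin n) ℤ) = Pi.single i 1) :
    g ∈ lowerElemGroup n ℤ k := by
  induction hk using Nat.decreasingInduction generalizing g with
  | self =>
    have : g = 1 := by
      apply Units.ext
      ext i j
      have := congrFun (hg i i.2) j
      rw [single_one_vecMul] at this
      simpa [Matrix.one_apply, Pi.single_apply, eq_comm] using this
    rw [this]; exact one_mem _
  | of_succ k hk ih =>
    let κ : Fin n := ⟨k, hk⟩
    have hrow : ∀ h : GL (Fin n) ℤ, ∀ i, Pi.single i 1 ᵥ* (h : Matrix (Fin n) (Fin n) ℤ) =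
        (h : Matrix (Fin n) (Fin n) ℤ) i := fun h i => by rw [single_one_vecMul]; rfl
    have hdvd : ∀ d : ℤ, (∀ i, κ ≤ i → d ∣ (g : Matrix (Fin n) (Fin n) ℤ) κ i) → IsUnit d := by
      intro d hd
      have h1 : ((g * g⁻¹ : GL (Fin n) ℤ) : Matrix (Fin n) (Fin n) ℤ) κ κ = 1 := by
        rw [mul_inv_cancel]; simp
      rw [Units.val_mul, Matrix.mul_apply] at h1
      refine isUnit_of_dvd_one (h1 ▸ Finset.dvd_sum fun i _ => ?_)
      by_cases hi : κ ≤ i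
      · exact (hd i hi).mul_right _
      · have hi' : i < κ := not_le.1 hi
        have := congrFun (vecMul_inv_eq (hg i hi')) κ
        rw [hrow, Pi.single_eq_of_ne hi'.ne'] at this
        rw [this, mul_zero]
        exact dvd_zero d
    obtain ⟨g₁, hg₁, h₁⟩ : ∃ g₁ ∈ lowerElemGroup n ℤ κ.val,
        ((g : Matrix (Fin n) (Fin n) ℤ) κ ᵥ* (g₁ : Matrix (Fin n) (Fin n) ℤ)) κ = 1 := by
      by_cases hkn : k + 1 < n
      · exact exists_lower_vecMul_apply_eq_one κ hkn _ hdvd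
      -- In the last row no neighbour is left for a sign change; g is lower triangular there, and
      -- its determinant is the remaining diagonal entry.
      · refine ⟨1, one_mem _, ?_⟩
        have htri : (g : Matrix (Fin n) (Fin n) ℤ).IsLowerTriangular := by
          intro i j hij
          have hij' : i < j := hij
          have hik : i.val < k := by have := j.2; have : i.val < j.val := hij'; omega
          have := congrFun (hg i hik) j
          rwa [hrow, Pi.single_eq_of_ne hij'.ne'] at this
        rw [det_of_isLowerTriangular _ htri, Finset.prod_eq_single κ] at hdet
        · simpa using hdet
        · intro i _ hi
          have hik : i.val < k := by
            have := i.2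
            have : i.val ≠ k := fun h => hi (Fin.ext h)
            omega
          have := congrFun (hg i hik) i
          rwa [hrow, Pi.single_eq_same] at this
        · simp
    obtain ⟨g₂, hg₂, h₂⟩ := exists_lower_vecMul_eq_single κ h₁
    have h12 : g₁ * g₂ ∈ lowerElemGroup n ℤ k := mul_mem hg₁ hg₂
    have := ih (g * (g₁ * g₂)) (by
        rw [Units.val_mul, det_mul, hdet, one_mul]
        exact det_of_mem_elemGroup (lowerElemGroup_le _ h12)) (by
        intro i hi
        rw [Units.val_mul, ← vecMul_vecMul]
        by_cases hik : i.val < k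
        · rw [hg i hik, single_vecMul_lower h12 hik]
        · have : i = κ := Fin.ext (by show i.val = k; omega)
          rw [this, hrow, Units.val_mul, ← vecMul_vecMul, h₂])
    have hm := mul_mem (lowerElemGroup_anti (Nat.le_succ k) this) (inv_mem h12)
    rwa [mul_inv_cancel_right] at hm

end StabilizerInt

/-! ### Rows modulo the relative elementary group -/

section RowEquivalence

variable {n : ℕ} [NeZero n] {R : Type*} [CommRing R] {I : Ideal R}

/-- Equivalence of rows under the action of `E_n(R, I)`. -/
def RowEquiv (I : Ideal R) (v w : Fin n → R) : Prop :=
  ∃ g ∈ elemGroupRel n R I, v ᵥ* (g : Matrix (Fin n) (Fin n) R) = w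

theorem RowEquiv.refl (v : Fin n → R) : RowEquiv I v v := ⟨1, one_mem _, by simp⟩

theorem RowEquiv.symm {v w : Fin n → R} : RowEquiv I v w → RowEquiv I w v := by
  rintro ⟨g, hg, rfl⟩
  refine ⟨g⁻¹, inv_mem hg, ?_⟩
  rw [vecMul_vecMul, ← Units.val_mul, mul_inv_cancel]
  simp

theorem RowEquiv.trans {u v w : Fin n → R} : RowEquiv I u v → RowEquiv I v w → RowEquiv I u w := by
  rintro ⟨g, hg, rfl⟩ ⟨k, hk, rfl⟩
  exact ⟨g * k, mul_mem hg hk, by rw [Units.val_mul, vecMul_vecMul]⟩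

theorem RowEquiv.vecMul {v w : Fin n → R} (h : RowEquiv I v w) {k : GL (Fin n) R}
    (hk : k ∈ elemGroup n R) :
    RowEquiv I (v ᵥ* (k : Matrix (Fin n) (Fin n) R)) (w ᵥ* (k : Matrix (Fin n) (Fin n) R)) := by
  obtain ⟨g, hg, rfl⟩ := h
  refine ⟨k⁻¹ * g * k, by simpa using conj_mem_elemGroupRel hg (inv_mem hk), ?_⟩
  rw [vecMul_vecMul, vecMul_vecMul, ← Units.val_mul, ← Units.val_mul]
  group

theorem RowEquiv.isUnimodular {v w : Fin n → R} (h : RowEquiv I v w) (hv : IsUnimodular v) :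
    IsUnimodular w := by
  obtain ⟨g, -, rfl⟩ := h
  exact hv.vecMul g

theorem MSERel.mk_eq_iff {v w : UmRel n R I} :
    MSERel.mk v = MSERel.mk w ↔ RowEquiv I v.1 w.1 := Quotient.eq

theorem MSE.mk_eq_of_rowEquiv {v w : Um n R} (h : RowEquiv I v.1 w.1) : MSE.mk v = MSE.mk w := by
  obtain ⟨g, hg, h⟩ := h
  exact MSE.mk_eq_iff.2 ⟨g, elemGroupRel_le hg, h⟩

theorem rowEquiv_update (hn : 3 ≤ n) {i j : Fin n} (hij : i ≠ j) {x : R} (hx : x ∈ I)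
    (v : Fin n → R) : RowEquiv I v (Function.update v j (v j + x * v i)) :=
  ⟨elemGL i j hij x, elemGL_mem_rel hn hij hx, vecMul_elemGL hij x v⟩

/-- An entry may be changed by `I`-multiples of the ideal generated by the other entries. -/
theorem rowEquiv_update_of_mem_span (hn : 3 ≤ n) (i : Fin n) (v : Fin n → R) {d m : R}
    (hd : d ∈ Ideal.span {x | ∃ j, j ≠ i ∧ x = v j}) (hm : m ∈ I) :
    RowEquiv I v (Function.update v i (v i + d * m)) := by
  -- Quantifying over m lets a scalar factor of d be absorbed into m; quantifying over the entry c
  -- lets successive changes be chained.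
  have key : ∀ m ∈ I, ∀ c, RowEquiv I (Function.update v i c) (Function.update v i (c + d * m)) := by
    induction hd using Submodule.span_induction with
    | mem x hx =>
      obtain ⟨j, hj, rfl⟩ := hx
      intro m hm c
      have := rowEquiv_update hn hj hm (Function.update v i c)
      simpa [hj, mul_comm] using this
    | zero => intro m _ c; simpa using RowEquiv.refl _
    | add x y _ _ hx hy =>
      intro m hm c
      have := (hx m hm c).trans (hy m hm _)
      rwa [add_assoc, ← add_mul] at this
    | smul r x _ hx =>
      intro m hm c
      have := hx (r * m) (I.mul_mem_left r hm) c
      rwa [show x * (r * m) = r • x * m by rw [smul_eq_mul]; ring] at this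
  simpa using key m hm (v i)

/-- A row is congruent to `e₁` modulo `I`. -/
def IsRelRow (I : Ideal R) (v : Fin n → R) : Prop :=
  v 0 - 1 ∈ I ∧ ∀ j, j ≠ 0 → v j ∈ I

theorem IsRelRow.vecMul_elemGL {v : Fin n → R} (hv : IsRelRow I v) {i j : Fin n} (hij : i ≠ j)
    (hi : i ≠ 0) (c : R) :
    IsRelRow I (v ᵥ* (elemGL i j hij c : Matrix (Fin n) (Fin n) R)) := by
  rw [_root_.vecMul_elemGL]
  have hci := I.mul_mem_left c (hv.2 i hi)
  constructor
  · by_cases hj : j = 0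
    · subst hj
      simpa [add_sub_right_comm] using I.add_mem hv.1 hci
    · simpa [Ne.symm hj] using hv.1
  · intro l hl
    by_cases hlj : l = j
    · subst hlj
      simpa using I.add_mem (hv.2 l hl) hci
    · simpa [hlj] using hv.2 l hl

/-- c v_i = (c v_i) v_0 + (-c (v_0 - 1)) v_i, and both coefficients lie in I: on such a row the
transvection acts as two relative ones. -/
theorem IsRelRow.rowEquiv_vecMul_elemGL_of_ne (hn : 3 ≤ n) {v : Fin n → R} (hv : IsRelRow I v)
    {i j : Fin n} (hij : i ≠ j) (hi : i ≠ 0) (hj : j ≠ 0) (c : R) :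
    RowEquiv I v (v ᵥ* (elemGL i j hij c : Matrix (Fin n) (Fin n) R)) := by
  have h1 := rowEquiv_update hn (Ne.symm hj) (I.mul_mem_left c (hv.2 i hi)) v
  have h2 := rowEquiv_update hn hij (I.mul_mem_left (-c) hv.1)
    (Function.update v j (v j + c * v i * v 0))
  refine h1.trans ?_
  convert h2 using 1
  rw [_root_.vecMul_elemGL]
  simp only [Function.update_self, Function.update_of_ne hij, Function.update_idem]
  congr 1
  ring

/-- The splitting through v_0 is not available when entry 0 itself is changed. There E_{i0}(c) is
the commutator of E_{ik}(c) and E_{k0}(1), and the two factors E_{ik}(±c) are harmless by the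
previous case. -/
theorem IsRelRow.rowEquiv_vecMul_elemGL (hn : 3 ≤ n) {v : Fin n → R} (hv : IsRelRow I v)
    {i j : Fin n} (hij : i ≠ j) (hi : i ≠ 0) (c : R) :
    RowEquiv I v (v ᵥ* (elemGL i j hij c : Matrix (Fin n) (Fin n) R)) := by
  by_cases hj : j = 0
  · subst hj
    obtain ⟨k, hki, hk0⟩ := exists_ne_ne hn i 0
    rw [← mul_one c, ← elemGL_commutator (Ne.symm hki) hk0 hij c 1]
    simp only [Units.val_mul, ← vecMul_vecMul]
    have a1 := (hv.rowEquiv_vecMul_elemGL_of_ne hn (Ne.symm hki) hi hk0 c).vecMul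
      (elemGL_mem hk0 (1 : R))
    have a2 := a1.vecMul (elemGL_mem (Ne.symm hki) (-c))
    have a3 := (hv.vecMul_elemGL hk0 hk0 1).rowEquiv_vecMul_elemGL_of_ne hn
      (Ne.symm hki) hi hk0 (-c)
    have a4 := (a3.trans a2).vecMul (elemGL_mem hk0 (-1 : R))
    rw [vecMul_vecMul v, ← Units.val_mul, elemGL_mul, add_neg_cancel] at a4
    simpa [elemGL_zero] using a4
  · exact hv.rowEquiv_vecMul_elemGL_of_ne hn hij hi hj c

theorem IsRelRow.rowEquiv_vecMul_lower (hn : 3 ≤ n) {g : GL (Fin n) R}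
    (hg : g ∈ lowerElemGroup n R 1) {v : Fin n → R} (hv : IsRelRow I v) :
    RowEquiv I v (v ᵥ* (g : Matrix (Fin n) (Fin n) R)) := by
  -- The claim is carried for g and g⁻¹ together, so that inverses cost nothing, and with
  -- preservation of relative rows, so that products can be chained.
  have key : ∀ g ∈ lowerElemGroup n R 1,
      (∀ v, IsRelRow I v → IsRelRow I (v ᵥ* (g : Matrix (Fin n) (Fin n) R)) ∧
        RowEquiv I v (v ᵥ* (g : Matrix (Fin n) (Fin n) R))) ∧
      (∀ v, IsRelRow I v → IsRelRow I (v ᵥ* ((g⁻¹ : GL (Fin n) R) : Matrix (Fin n) (Fin n) R)) ∧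
        RowEquiv I v (v ᵥ* ((g⁻¹ : GL (Fin n) R) : Matrix (Fin n) (Fin n) R))) := by
    intro g hg
    induction hg using Subgroup.closure_induction with
    | mem g hg =>
      obtain ⟨i, j, h, c, hi, rfl⟩ := hg
      have hi0 : i ≠ 0 := by rintro rfl; simp at hi
      rw [elemGL_inv]
      exact ⟨fun v hv => ⟨hv.vecMul_elemGL h hi0 c, hv.rowEquiv_vecMul_elemGL hn h hi0 c⟩,
        fun v hv => ⟨hv.vecMul_elemGL h hi0 _, hv.rowEquiv_vecMul_elemGL hn h hi0 _⟩⟩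
    | one => simpa using fun v hv => ⟨hv, RowEquiv.refl v⟩
    | mul g k _ _ hg hk =>
      simp only [_root_.mul_inv_rev, Units.val_mul, ← vecMul_vecMul]
      exact ⟨fun v hv => ⟨(hk.1 _ (hg.1 v hv).1).1,
          (hg.1 v hv).2.trans (hk.1 _ (hg.1 v hv).1).2⟩,
        fun v hv => ⟨(hg.2 _ (hk.2 v hv).1).1,
          (hk.2 v hv).2.trans (hg.2 _ (hk.2 v hv).1).2⟩⟩
    | inv g _ hg => rw [inv_inv]; exact ⟨hg.2, hg.1⟩
  exact ((key g hg).1 v hv).2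

theorem isRelRow_iff_map_eq {S : Type*} [CommRing S] (π : R →+* S) (v : Fin n → R) :
    IsRelRow (RingHom.ker π) v ↔ (fun j => π (v j)) = Pi.single 0 1 := by
  constructor
  · rintro ⟨h0, h⟩
    ext j
    by_cases hj : j = 0
    · subst hj
      rw [RingHom.mem_ker, map_sub, map_one, sub_eq_zero] at h0
      simpa using h0
    · rw [Pi.single_eq_of_ne hj]
      exact h j hj
  · intro h
    refine ⟨?_, fun j hj => ?_⟩
    · have := congrFun h 0
      rw [RingHom.mem_ker, map_sub, map_one, sub_eq_zero]
      simpa using this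
    · have := congrFun h j
      rw [Pi.single_eq_of_ne hj] at this
      exact this

/-- For an augmented ring over `ℤ`, rows congruent to `e₁` modulo the augmentation ideal `J` which
are `E_n`-equivalent are `E_n(·, J)`-equivalent. -/
theorem rowEquiv_ker_of_elem_int (hn : 3 ≤ n) (π : R →+* ℤ) {v w : Fin n → R}
    (hv : IsRelRow (RingHom.ker π) v) (hw : IsRelRow (RingHom.ker π) w)
    {g : GL (Fin n) R} (hg : g ∈ elemGroup n R)
    (h : v ᵥ* (g : Matrix (Fin n) (Fin n) R) = w) : RowEquiv (RingHom.ker π) v w := by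
  set ε := GeneralLinearGroup.map π g with hε
  have hεm : ε ∈ elemGroup n ℤ := elemGroup_map π hg
  have hfix : Pi.single (0 : Fin n) 1 ᵥ* (ε : Matrix (Fin n) (Fin n) ℤ) = Pi.single 0 1 := by
    rw [← (isRelRow_iff_map_eq π v).1 hv, ← vecMul_map, h, (isRelRow_iff_map_eq π v).1 hv,
      (isRelRow_iff_map_eq π w).1 hw]
  have hlow : ε ∈ lowerElemGroup n ℤ 1 := by
    refine mem_lower_of_fixes 1 (by omega) ε (det_of_mem_elemGroup hεm) ?_
    intro i hi
    have : i = 0 := Fin.val_eq_zero_iff.1 (by omega)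
    rw [this, hfix]
  -- g is an element of the relative group times the image ε' of ε under ℤ → R. As ε fixes e₁, ε' is
  -- lower, so ε'⁻¹ leaves the relative class of w unchanged.
  have hk := mul_inv_section_mem hn π (Int.castRingHom R) (by simp) (J := RingHom.ker π)
    (fun x hx => hx) hg
  rw [← hε] at hk
  set ε' := GeneralLinearGroup.map (Int.castRingHom R) ε with hε'
  have hlow' : ε'⁻¹ ∈ lowerElemGroup n R 1 := inv_mem (map_mem_lowerElemGroup _ hlow)
  have h1 := hw.rowEquiv_vecMul_lower hn hlow'
  refine RowEquiv.trans ⟨_, hk, ?_⟩ h1.symm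
  rw [Units.val_mul, ← vecMul_vecMul, h]

end RowEquivalence

/-! ### Functoriality and dual rows -/

section Functoriality

variable {n : ℕ} [NeZero n] {A B : Type*} [CommRing A] [CommRing B] {I : Ideal A} {J : Ideal B}

theorem RowEquiv.map (f : A →+* B) (hf : ∀ x ∈ I, f x ∈ J) {v w : Fin n → A}
    (h : RowEquiv I v w) : RowEquiv J (fun j => f (v j)) (fun j => f (w j)) := by
  obtain ⟨g, hg, rfl⟩ := h
  exact ⟨_, elemGroupRel_map f hf hg, (vecMul_map f v g).symm⟩

theorem IsRelRow.map (f : A →+* B) (hf : ∀ x ∈ I, f x ∈ J) {v : Fin n → A} (h : IsRelRow I v) :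
    IsRelRow J (fun j => f (v j)) :=
  ⟨by simpa using hf _ h.1, fun j hj => hf _ (h.2 j hj)⟩

theorem map_vvRow (f : A →+* B) (v : Fin n → A) (b p : A) :
    (fun j => f (vvRow v b p j)) = vvRow (fun j => f (v j)) (f b) (f p) := by
  ext j
  simp only [vvRow]
  split_ifs <;> simp

theorem vvRow_single_one : vvRow (Pi.single (0 : Fin n) (1 : A)) 1 1 = Pi.single 0 1 := by
  ext j
  simp only [vvRow]
  split_ifs with h0 h1
  · subst h0; simp
  · subst h1; simp [h0]
  · rfl

end Functoriality

section Duals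

variable {n : ℕ} {R : Type*} [CommRing R]

theorem mul_sub_one_mem_span {v w : Fin n → R} (h : v ⬝ᵥ w = 1) (i : Fin n) :
    v i * w i - 1 ∈ Ideal.span {x | ∃ j, j ≠ i ∧ x = v j} := by
  have h' : v i * w i - 1 = -∑ j ∈ Finset.univ.erase i, v j * w j := by
    rw [← h, dotProduct, ← Finset.add_sum_erase _ _ (Finset.mem_univ i)]
    ring
  rw [h']
  refine neg_mem (Ideal.sum_mem _ fun j hj => Ideal.mul_mem_right _ _ (Ideal.subset_span ?_))
  exact ⟨j, Finset.ne_of_mem_erase hj, rfl⟩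

theorem IsUnimodular.exists_dual_isRelRow [NeZero n] {I : Ideal R} {v : Fin n → R}
    (hv : IsUnimodular v) (h0 : v 0 - 1 ∈ I) : ∃ w, v ⬝ᵥ w = 1 ∧ IsRelRow I w := by
  obtain ⟨w, hw⟩ := hv
  have h1 : 1 - v 0 ∈ I := by simpa using I.neg_mem h0
  -- The pairing with v is v₀ + (1 - v₀) · 1 = 1.
  refine ⟨Pi.single 0 1 + (1 - v 0) • w, ?_, ?_, fun j hj => ?_⟩
  · rw [dotProduct_add, dotProduct_smul, hw]
    simp
  · simpa using I.mul_mem_right _ h1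
  · simpa [hj] using I.mul_mem_right _ h1

theorem span_others_congr {v w : Fin n → R} {i : Fin n} (h : ∀ j, j ≠ i → w j = v j) :
    Ideal.span {x | ∃ j, j ≠ i ∧ x = w j} = Ideal.span {x | ∃ j, j ≠ i ∧ x = v j} := by
  congr 1
  ext x
  exact exists_congr fun j => and_congr_right fun hj => by rw [h j hj]

end Duals

/-! ### Lifting rows and matrices to excision rings -/

section Lifting

variable {n : ℕ} [NeZero n] {R : Type*} [CommRing R]

/-- The ring homomorphism `R ⊕ I → R`, `(r, i) ↦ r + i`. -/
def ExcisionRing.toRing (I : Ideal R) : ExcisionRing I →+* R where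
  toFun x := x.fst + (x.snd : R)
  map_one' := by simp
  map_zero' := by simp
  map_add' x y := by
    simp only [Unitization.fst_add, Unitization.snd_add, Submodule.coe_add]
    ring
  map_mul' x y := by
    simp
    ring

/-- The ring homomorphism `ℤ ⊕ I → R ⊕ I`, `(m, i) ↦ (m, i)`. -/
def IntExcisionRing.toExcision (I : Ideal R) : IntExcisionRing I →+* ExcisionRing I where
  toFun x := ⟨((x.fst : R), x.snd)⟩
  map_one' := by ext <;> simp
  map_zero' := by ext <;> simp
  map_add' x y := by ext <;> simp
  map_mul' x y := by ext <;> simp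

/-- The augmentation `ℤ ⊕ I → ℤ`. -/
def IntExcisionRing.aug (I : Ideal R) : IntExcisionRing I →+* ℤ :=
  (Unitization.fstHom ℤ I : IntExcisionRing I →+* ℤ)

/-- The augmentation `R ⊕ I → R`. -/
def ExcisionRing.aug (I : Ideal R) : ExcisionRing I →+* R :=
  (Unitization.fstHom R I : ExcisionRing I →+* R)

/-- The section `R → R ⊕ I` of the augmentation. -/
def ExcisionRing.incl (I : Ideal R) : R →+* ExcisionRing I := Unitization.inlRingHom R I

variable {I : Ideal R}

theorem ExcisionRing.aug_incl (r : R) : aug I (incl I r) = r := rfl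

theorem ExcisionRing.toRing_incl (r : R) : toRing I (incl I r) = r := by
  simp [toRing, incl]

theorem IntExcisionRing.aug_toExcision (x : IntExcisionRing I) :
    ExcisionRing.aug I (toExcision I x) = (aug I x : R) := by
  simp [ExcisionRing.aug, toExcision, aug]

theorem IntExcisionRing.toRing_toExcision (x : IntExcisionRing I) :
    ExcisionRing.toRing I (toExcision I x) = toRing I x := by
  simp [ExcisionRing.toRing, toExcision, toRing]

theorem ExcisionRing.ext_of_aug {x y : ExcisionRing I} (h : aug I x = aug I y)
    (h' : toRing I x = toRing I y) : x = y := by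
  have h1 : x.fst = y.fst := h
  have h2 : x.fst + (x.snd : R) = y.fst + (y.snd : R) := h'
  refine Unitization.ext h1 (Subtype.ext ?_)
  rw [h1] at h2
  exact add_left_cancel h2

theorem IntExcisionRing.ext_of_aug {x y : IntExcisionRing I} (h : aug I x = aug I y)
    (h' : toRing I x = toRing I y) : x = y := by
  have h1 : x.fst = y.fst := h
  have h2 : (x.fst : R) + (x.snd : R) = y.fst + (y.snd : R) := h'
  refine Unitization.ext h1 (Subtype.ext ?_)
  rw [h1] at h2
  exact add_left_cancel h2

theorem ExcisionRing.toRing_mem : ∀ x ∈ RingHom.ker (aug I), toRing I x ∈ I := by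
  intro x hx
  have h : x.fst = 0 := hx
  simp [toRing, h]

theorem IntExcisionRing.exists_lift (m : ℤ) {x : R} (h : x - m ∈ I) :
    ∃ y : IntExcisionRing I, aug I y = m ∧ toRing I y = x :=
  ⟨Unitization.inl m + Unitization.inr ⟨x - m, h⟩, by simp [aug], by simp [toRing]⟩

theorem IsRelRow.exists_lift {v : Fin n → R} (hv : IsRelRow I v) :
    ∃ y : Fin n → IntExcisionRing I, (fun j => IntExcisionRing.aug I (y j)) = Pi.single 0 1 ∧
      (fun j => IntExcisionRing.toRing I (y j)) = v := by
  have : ∀ j, ∃ y : IntExcisionRing I, IntExcisionRing.aug I y = (Pi.single 0 1 : Fin n → ℤ) j ∧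
      IntExcisionRing.toRing I y = v j := by
    intro j
    refine IntExcisionRing.exists_lift _ ?_
    by_cases hj : j = 0
    · subst hj; simpa using hv.1
    · simpa [hj] using hv.2 j hj
  choose y hy using this
  exact ⟨y, funext fun j => (hy j).1, funext fun j => (hy j).2⟩

/-- The row over `ℤ ⊕ I` congruent to `e₁` modulo `0 ⊕ I` with a given image in `R`. -/
noncomputable def IsRelRow.lift {v : Fin n → R} (hv : IsRelRow I v) : Fin n → IntExcisionRing I :=
  hv.exists_lift.choose

theorem IsRelRow.aug_lift {v : Fin n → R} (hv : IsRelRow I v) (j : Fin n) :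
    IntExcisionRing.aug I (hv.lift j) = (Pi.single 0 1 : Fin n → ℤ) j :=
  congrFun hv.exists_lift.choose_spec.1 j

theorem IsRelRow.toRing_lift {v : Fin n → R} (hv : IsRelRow I v) (j : Fin n) :
    IntExcisionRing.toRing I (hv.lift j) = v j :=
  congrFun hv.exists_lift.choose_spec.2 j

theorem IsRelRow.isRelRow_lift {v : Fin n → R} (hv : IsRelRow I v) :
    IsRelRow (RingHom.ker (IntExcisionRing.aug I)) hv.lift :=
  (isRelRow_iff_map_eq _ _).2 (funext hv.aug_lift)

theorem IsRelRow.lift_dotProduct {v w : Fin n → R} (hv : IsRelRow I v) (hw : IsRelRow I w)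
    (h : v ⬝ᵥ w = 1) : hv.lift ⬝ᵥ hw.lift = 1 := by
  apply IntExcisionRing.ext_of_aug
  · rw [dotProduct, map_sum]
    simp only [map_mul, hv.aug_lift, hw.aug_lift, map_one]
    simp [Pi.single_apply]
  · rw [dotProduct, map_sum]
    simp only [map_mul, hv.toRing_lift, hw.toRing_lift, map_one]
    exact h

theorem UmRel.isRelRow (v : UmRel n R I) : IsRelRow I v.1 := v.2.2

theorem isUnimodular_lift (v : UmRel n R I) : IsUnimodular ((UmRel.isRelRow v).lift) := by
  obtain ⟨w, hw, hwI⟩ := v.2.1.exists_dual_isRelRow v.2.2.1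
  exact ⟨hwI.lift, (UmRel.isRelRow v).lift_dotProduct hwI hw⟩

/-- The unimodular row over `R ⊕ I` congruent to `e₁` modulo `0 ⊕ I` with a given image in `R`. -/
noncomputable def UmRel.lift (v : UmRel n R I) : Um n (ExcisionRing I) :=
  ⟨fun j => IntExcisionRing.toExcision I ((UmRel.isRelRow v).lift j), (isUnimodular_lift v).map _⟩

theorem UmRel.aug_lift (v : UmRel n R I) (j : Fin n) :
    ExcisionRing.aug I ((UmRel.lift v).1 j) = (Pi.single 0 1 : Fin n → R) j := by
  simp only [UmRel.lift]
  rw [IntExcisionRing.aug_toExcision, IsRelRow.aug_lift]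
  by_cases hj : j = 0
  · subst hj; simp
  · simp [hj]

theorem UmRel.toRing_lift (v : UmRel n R I) (j : Fin n) :
    ExcisionRing.toRing I ((UmRel.lift v).1 j) = v.1 j := by
  simp only [UmRel.lift]
  rw [IntExcisionRing.toRing_toExcision, IsRelRow.toRing_lift]

theorem UmRel.eq_lift {v : UmRel n R I} {y : Fin n → ExcisionRing I}
    (h : (fun j => ExcisionRing.aug I (y j)) = Pi.single 0 1)
    (hR : (fun j => ExcisionRing.toRing I (y j)) = v.1) : y = (UmRel.lift v).1 := by
  ext1 j
  apply ExcisionRing.ext_of_aug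
  · rw [UmRel.aug_lift, ← h]
  · rw [UmRel.toRing_lift, ← hR]

/-- Elements of `E_n(R, I)` lift to elements of `E_n(R ⊕ I)` that are trivial modulo `0 ⊕ I`. -/
theorem exists_lift_of_mem_elemGroupRel (hn : 3 ≤ n) {g : GL (Fin n) R}
    (hg : g ∈ elemGroupRel n R I) :
    ∃ k ∈ elemGroup n (ExcisionRing I), GeneralLinearGroup.map (ExcisionRing.aug I) k = 1 ∧
      GeneralLinearGroup.map (ExcisionRing.toRing I) k = g := by
  obtain ⟨g, hg, rfl⟩ := hg
  -- The liftable matrices form a normal subgroup because R → R ⊕ I lifts the conjugating matrix; so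
  -- it suffices to lift the generators.
  let N : Subgroup (elemGroup n R) :=
    { carrier := {g | ∃ k ∈ elemGroup n (ExcisionRing I),
        GeneralLinearGroup.map (ExcisionRing.aug I) k = 1 ∧
        GeneralLinearGroup.map (ExcisionRing.toRing I) k = g}
      one_mem' := ⟨1, one_mem _, by simp, by simp⟩
      mul_mem' := by
        rintro a b ⟨k, hk, h1, h2⟩ ⟨l, hl, h3, h4⟩
        exact ⟨k * l, mul_mem hk hl, by simp [h1, h3], by simp [h2, h4]⟩
      inv_mem' := by
        rintro a ⟨k, hk, h1, h2⟩
        exact ⟨k⁻¹, inv_mem hk, by simp [h1], by simp [h2]⟩ }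
  have hN : N.Normal := by
    constructor
    rintro a ⟨k, hk, h1, h2⟩ b
    have hb : GeneralLinearGroup.map (ExcisionRing.toRing I)
        (GeneralLinearGroup.map (ExcisionRing.incl I) (b : GL (Fin n) R)) = b := by
      ext i j
      exact ExcisionRing.toRing_incl _
    refine ⟨GeneralLinearGroup.map (ExcisionRing.incl I) b * k *
      (GeneralLinearGroup.map (ExcisionRing.incl I) b)⁻¹, ?_, ?_, ?_⟩
    · have := elemGroup_map (ExcisionRing.incl I) b.2
      exact mul_mem (mul_mem this hk) (inv_mem this)
    · simp [h1]
    · rw [map_mul, map_mul, map_inv, hb, h2]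
      rfl
  refine (Subgroup.normalClosure_le_normal (N := N) ?_) hg
  rintro g ⟨x, hx, h⟩
  have h10 := one_ne_zero_fin hn
  refine ⟨elemGL 1 0 h10 (Unitization.inr ⟨x, hx⟩), elemGL_mem h10 _, ?_, ?_⟩
  · rw [map_elemGL, ← elemGL_zero h10]
    rfl
  · rw [map_elemGL]
    apply Units.ext
    rw [h, elemGL_val]
    simp [ExcisionRing.toRing]

end Lifting

/-! ### The map φ to the excision ring -/

section ExcisionMap

variable {n : ℕ} [NeZero n] {R : Type*} [CommRing R] {I : Ideal R}

theorem UmRel.mk_lift_eq (hn : 3 ≤ n) {v w : UmRel n R I} (h : RowEquiv I v.1 w.1) :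
    MSE.mk (UmRel.lift v) = MSE.mk (UmRel.lift w) := by
  obtain ⟨g, hg, h⟩ := h
  obtain ⟨k, hk, h1, h2⟩ := exists_lift_of_mem_elemGroupRel hn hg
  refine MSE.mk_eq_iff.2 ⟨k, hk, UmRel.eq_lift ?_ ?_⟩
  · rw [vecMul_map, h1, funext (UmRel.aug_lift v)]
    simp
  · rw [vecMul_map, h2, funext (UmRel.toRing_lift v), h]

/-- The map `MSE_n(R, I) → MSE_n(R ⊕ I)` which lifts a row congruent to `e₁` modulo `I` to the one
congruent to `e₁` modulo `0 ⊕ I`. -/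
noncomputable def MSERel.toExcision (hn : 3 ≤ n) : MSERel n R I → MSE n (ExcisionRing I) :=
  Quotient.lift (fun v => MSE.mk (UmRel.lift v)) fun _ _ h => UmRel.mk_lift_eq hn h

theorem MSERel.toExcision_mk (hn : 3 ≤ n) (v : UmRel n R I) :
    MSERel.toExcision hn (MSERel.mk v) = MSE.mk (UmRel.lift v) := rfl

theorem MSERel.exists_rep (x : MSERel n R I) : ∃ v : UmRel n R I, MSERel.mk v = x :=
  Quotient.exists_rep x

theorem isRelRow_single : IsRelRow I (Pi.single (0 : Fin n) (1 : R)) :=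
  ⟨by simp, fun j hj => by simp [hj]⟩

/-- The base point `e₁` of `Um_n(R, I)`. -/
def UmRel.base (n : ℕ) [NeZero n] (I : Ideal R) : UmRel n R I :=
  ⟨Pi.single 0 1, ⟨Pi.single 0 1, by simp⟩, isRelRow_single⟩

theorem UmRel.lift_base : (UmRel.lift (UmRel.base n I)).1 = Pi.single 0 1 := by
  refine (UmRel.eq_lift ?_ ?_).symm <;>
  · ext j
    by_cases hj : j = 0
    · subst hj; simp [UmRel.base]
    · simp [hj, UmRel.base]

/-- The map `MSE_n(R, I) → MSE_n(R ⊕ I)` has trivial kernel. -/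
theorem MSERel.eq_base_of_toExcision_eq (hn : 3 ≤ n) {x : MSERel n R I}
    (hx : MSERel.toExcision hn x = MSERel.toExcision hn (MSERel.mk (UmRel.base n I))) :
    x = MSERel.mk (UmRel.base n I) := by
  obtain ⟨v, rfl⟩ := MSERel.exists_rep x
  obtain ⟨g, hg, h⟩ := MSE.mk_eq_iff.1 hx
  rw [UmRel.lift_base] at h
  have hk := mul_inv_section_mem hn (ExcisionRing.aug I) (ExcisionRing.incl I)
    ExcisionRing.aug_incl (J := RingHom.ker (ExcisionRing.aug I)) (fun _ hx => hx) hg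
  set ε := GeneralLinearGroup.map (ExcisionRing.aug I) g with hε
  have hsingle : ∀ {A B : Type _} [CommRing A] [CommRing B] (f : A →+* B),
      (fun j => f ((Pi.single 0 1 : Fin n → A) j)) = Pi.single 0 1 := by
    intro A B _ _ f
    ext j
    by_cases hj : j = 0
    · subst hj; simp
    · simp [hj]
  have hfix : Pi.single (0 : Fin n) 1 ᵥ* (ε : Matrix (Fin n) (Fin n) R) = Pi.single 0 1 := by
    rw [← funext (UmRel.aug_lift v), hε, ← vecMul_map, h, funext (UmRel.aug_lift v), hsingle]
  have hfix' : Pi.single (0 : Fin n) 1 ᵥ* (GeneralLinearGroup.map (ExcisionRing.incl I) ε :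
      Matrix (Fin n) (Fin n) (ExcisionRing I)) = Pi.single 0 1 := by
    rw [← hsingle (ExcisionRing.incl I), ← vecMul_map, hfix]
  -- The image of ε in E_n(R ⊕ I) fixes e₁, so after division by it g still sends the lifted row to
  -- e₁ and now lies in the relative group.
  have h2 : RowEquiv (RingHom.ker (ExcisionRing.aug I)) (UmRel.lift v).1 (Pi.single 0 1) := by
    refine ⟨_, hk, ?_⟩
    rw [Units.val_mul, ← vecMul_vecMul, h, vecMul_inv_eq hfix']
  have h3 := h2.map (ExcisionRing.toRing I) ExcisionRing.toRing_mem
  rw [hsingle, funext (UmRel.toRing_lift v)] at h3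
  exact MSERel.mk_eq_iff.2 h3

variable [Group (MSERel n R I)] [Group (MSE n (ExcisionRing I))]

/-- Rows of `Um_n(R, I)` with common tails multiply by the Vaserstein–van der Kallen rule, and
`MSE_n(R, I) → MSE_n(R ⊕ I)` respects such products. -/
theorem MSERel.exists_mk_mul_mk (hn : 3 ≤ n)
    (hrel : IsVvRuleRel (fun x y : MSERel n R I => x * y))
    (habs : IsVvRule (fun x y : MSE n (ExcisionRing I) => x * y))
    (v w : UmRel n R I) (h : ∀ j, j ≠ 0 → w.1 j = v.1 j) :
    ∃ (p : R) (u : UmRel n R I), u.1 = vvRow v.1 (w.1 0) p ∧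
      MSERel.mk w * MSERel.mk v = MSERel.mk u ∧
      MSERel.toExcision hn (MSERel.mk u) =
        MSERel.toExcision hn (MSERel.mk w) * MSERel.toExcision hn (MSERel.mk v) := by
  obtain ⟨op', hind, hvv⟩ := hrel
  obtain ⟨z, hz⟩ := MSERel.exists_rep (MSERel.mk w * MSERel.mk v)
  have hv := UmRel.isRelRow v
  have hw := UmRel.isRelRow w
  have hzr := UmRel.isRelRow z
  -- With the dual row congruent to e₁, p = d 0 is 1 modulo I, which keeps the row of the rule
  -- congruent to e₁.
  obtain ⟨d, hd, hdr⟩ := v.2.1.exists_dual_isRelRow v.2.2.1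
  let L : UmRel n R I → UmRel n (IntExcisionRing I) (IntExcisionRing.ideal I) := fun v =>
    ⟨(UmRel.isRelRow v).lift, isUnimodular_lift v, (UmRel.isRelRow v).isRelRow_lift⟩
  have hF : ∀ v, excisionF n I (MSERel.mk (L v)) = MSERel.mk v := fun v =>
    congrArg MSERel.mk (Subtype.ext (funext (UmRel.isRelRow v).toRing_lift))
  have h1 := hind (MSERel.mk (L w)) (MSERel.mk (L v)) (MSERel.mk (L z)) (by
    rw [hF, hF, hF]; exact hz)
  have hdot := hv.lift_dotProduct hdr hd
  have hagree : ∀ j, j ≠ 0 → hw.lift j = hv.lift j := fun j hj =>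
    IntExcisionRing.ext_of_aug (by rw [hv.aug_lift, hw.aug_lift])
      (by rw [hv.toRing_lift, hw.toRing_lift, h j hj])
  obtain ⟨hU, h2⟩ := hvv ⟨hv.lift, isUnimodular_lift v⟩ ⟨hw.lift, isUnimodular_lift w⟩ hagree
    (hdr.lift 0) (mul_sub_one_mem_span hdot 0)
  have h3 : MSE.mk ⟨hzr.lift, isUnimodular_lift z⟩ =
      MSE.mk ⟨vvRow hv.lift (hw.lift 0) (hdr.lift 0), hU⟩ := h1.symm.trans h2
  obtain ⟨g, hg, h4⟩ := MSE.mk_eq_iff.1 h3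
  have hvvrel : IsRelRow (RingHom.ker (IntExcisionRing.aug I))
      (vvRow hv.lift (hw.lift 0) (hdr.lift 0)) := by
    rw [isRelRow_iff_map_eq, map_vvRow, funext hv.aug_lift, hw.aug_lift, hdr.aug_lift]
    simpa using vvRow_single_one
  -- E_n-equivalence over ℤ ⊕ I is upgraded to relative equivalence, the form that maps to R.
  have h5 := (rowEquiv_ker_of_elem_int hn _ hzr.isRelRow_lift hvvrel hg h4).map
    (IntExcisionRing.toRing I) (IntExcisionRing.toRing_mem I)
  have h6 := hvvrel.map (IntExcisionRing.toRing I) (IntExcisionRing.toRing_mem I)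
  rw [map_vvRow, funext hv.toRing_lift, hw.toRing_lift, hdr.toRing_lift] at h5 h6
  rw [funext hzr.toRing_lift] at h5
  let u : UmRel n R I := ⟨vvRow v.1 (w.1 0) (d 0), h5.isUnimodular z.2.1, h6⟩
  refine ⟨d 0, u, rfl, ?_, ?_⟩
  · rw [← hz]
    exact MSERel.mk_eq_iff.2 h5
  · let ι := IntExcisionRing.toExcision I
    have hp : (UmRel.lift v).1 0 * ι (hdr.lift 0) - 1 ∈
        Ideal.span {x | ∃ j, j ≠ 0 ∧ x = (UmRel.lift v).1 j} := by
      refine mul_sub_one_mem_span (w := fun j => ι (hdr.lift j)) ?_ 0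
      have := congrArg ι hdot
      rw [map_one] at this
      rw [← this, dotProduct, dotProduct, map_sum]
      simp [UmRel.lift, ι]
    obtain ⟨hU', h7⟩ := habs (UmRel.lift v) (UmRel.lift w)
      (fun j hj => congrArg ι (hagree j hj)) _ hp
    rw [MSERel.toExcision_mk, MSERel.toExcision_mk, MSERel.toExcision_mk]
    refine Eq.trans (congrArg MSE.mk (Subtype.ext ?_)) h7.symm
    refine (UmRel.eq_lift ?_ ?_).symm
    · rw [map_vvRow, funext (UmRel.aug_lift v), UmRel.aug_lift w,
        IntExcisionRing.aug_toExcision, hdr.aug_lift]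
      simpa using vvRow_single_one
    · rw [map_vvRow, funext (UmRel.toRing_lift v), UmRel.toRing_lift w,
        IntExcisionRing.toRing_toExcision, hdr.toRing_lift]

end ExcisionMap

/-! ### Producing common tails -/

section UpdateRows

variable {n : ℕ} [NeZero n] {R : Type*} [CommRing R] {I : Ideal R}

theorem IsRelRow.update_zero {v : Fin n → R} (hv : IsRelRow I v) {x : R} (hx : x - 1 ∈ I) :
    IsRelRow I (Function.update v 0 x) :=
  ⟨by simpa using hx, fun j hj => by simpa [hj] using hv.2 j hj⟩

theorem IsRelRow.update_of_ne {v : Fin n → R} (hv : IsRelRow I v) {i : Fin n} (hi : i ≠ 0) {x : R}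
    (hx : x ∈ I) : IsRelRow I (Function.update v i x) := by
  refine ⟨by simpa [Ne.symm hi] using hv.1, fun j hj => ?_⟩
  by_cases hji : j = i
  · subst hji; simpa using hx
  · simpa [hji] using hv.2 j hj

theorem IsRelRow.update {v w : Fin n → R} (hv : IsRelRow I v) (hw : IsRelRow I w) (i : Fin n) :
    IsRelRow I (Function.update v i (w i)) := by
  by_cases hi : i = 0
  · subst hi; exact hv.update_zero hw.1
  · exact hv.update_of_ne hi (hw.2 i hi)

theorem IsRelRow.update_mul {v w : Fin n → R} (hv : IsRelRow I v) (hw : IsRelRow I w) (i : Fin n) :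
    IsRelRow I (Function.update v i (v i * w i)) := by
  by_cases hi : i = 0
  · subst hi
    refine hv.update_zero ?_
    have := I.add_mem (I.mul_mem_left (v 0) hw.1) hv.1
    rwa [show v 0 * (w 0 - 1) + (v 0 - 1) = v 0 * w 0 - 1 by ring] at this
  · exact hv.update_of_ne hi (I.mul_mem_left _ (hw.2 i hi))

/-- Two relative rows that agree outside the coordinates `0` and `i` are equivalent to rows with
common tails, if the `i`-th entry of the second is invertible modulo the entries `≠ i` of the
first. -/
theorem exists_common_tail (hn : 3 ≤ n) {i : Fin n} (hi : i ≠ 0) (v w : UmRel n R I)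
    (h : ∀ j, j ≠ 0 → j ≠ i → w.1 j = v.1 j) {σ : R}
    (hσ : w.1 i * σ - 1 ∈ Ideal.span {x | ∃ j, j ≠ i ∧ x = v.1 j}) :
    ∃ (t : R) (v' w' : UmRel n R I), MSERel.mk v' = MSERel.mk v ∧ MSERel.mk w' = MSERel.mk w ∧
      (∀ j, j ≠ 0 → w'.1 j = v'.1 j) ∧ v'.1 = Function.update v.1 i t := by
  have hv := UmRel.isRelRow v
  have hw := UmRel.isRelRow w
  have hw0 : 1 - w.1 0 ∈ I := by simpa using I.neg_mem hw.1
  -- 1 - b = (1 - w₀)(1 - σ w_i) lies in the ideal of the entries of v other than v_i. Hence v_i may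
  -- be moved by (1 - b)(w_i - v_i), and subtracting b (w_i - v_i) from w_i gives the same t.
  set b := w.1 0 + σ * (1 - w.1 0) * w.1 i with hb
  set t := v.1 i + (1 - b) * (w.1 i - v.1 i) with ht
  have hdiff : w.1 i - v.1 i ∈ I := I.sub_mem (hw.2 i hi) (hv.2 i hi)
  have hmem : 1 - b ∈ Ideal.span {x | ∃ j, j ≠ i ∧ x = v.1 j} := by
    have := Ideal.mul_mem_left _ (-(1 - w.1 0)) hσ
    rwa [show -(1 - w.1 0) * (w.1 i * σ - 1) = 1 - b by rw [hb]; ring] at this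
  have ev : RowEquiv I v.1 (Function.update v.1 i t) :=
    rowEquiv_update_of_mem_span hn i v.1 hmem hdiff
  have ew : RowEquiv I w.1 (Function.update (Function.update w.1 0 b) i t) := by
    refine (rowEquiv_update hn hi (I.mul_mem_left σ hw0) w.1).trans ?_
    have := rowEquiv_update hn (Ne.symm hi) (I.neg_mem hdiff) (Function.update w.1 0 b)
    convert this using 2
    rw [Function.update_of_ne hi, Function.update_self, ht]
    ring
  have htI : t ∈ I := I.add_mem (hv.2 i hi) (I.mul_mem_left _ hdiff)
  have hbI : b - 1 ∈ I := by
    have := I.add_mem hw.1 (I.mul_mem_right (w.1 i) (I.mul_mem_left σ hw0))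
    rwa [show w.1 0 - 1 + σ * (1 - w.1 0) * w.1 i = b - 1 by rw [hb]; ring] at this
  refine ⟨t, ⟨_, ev.isUnimodular v.2.1, hv.update_of_ne hi htI⟩,
    ⟨_, ew.isUnimodular w.2.1, (hw.update_zero hbI).update_of_ne hi htI⟩,
    MSERel.mk_eq_iff.2 ev.symm, MSERel.mk_eq_iff.2 ew.symm, fun j hj => ?_, rfl⟩
  by_cases hji : j = i
  · subst hji; simp
  · simp [hji, hj, h j hj hji]

end UpdateRows

/-! ### Consequences of niceness over a ring -/

section NiceAbsolute

variable {n : ℕ} [NeZero n] {R : Type*} [CommRing R]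

theorem exists_elem_vecMul_eq_swap {i : Fin n} (hi : i ≠ 0) :
    ∃ g ∈ elemGroup n R, ∀ v : Fin n → R, v ᵥ* (g : Matrix (Fin n) (Fin n) R) =
      Function.update (Function.update v i (-v 0)) 0 (v i) := by
  refine ⟨elemGL i 0 hi 1 * elemGL 0 i hi.symm (-1) * elemGL i 0 hi 1,
    mul_mem (mul_mem (elemGL_mem _ _) (elemGL_mem _ _)) (elemGL_mem _ _), fun v => ?_⟩
  rw [Units.val_mul, Units.val_mul, ← vecMul_vecMul, ← vecMul_vecMul, vecMul_elemGL, vecMul_elemGL,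
    vecMul_elemGL]
  ext j
  by_cases hj : j = 0
  · subst hj
    simp [hi, hi.symm]
  · by_cases hji : j = i
    · subst hji
      simp [hj, Ne.symm hj]
    · simp [hj, hji]

/-- Niceness in the first coordinate implies niceness in every coordinate. -/
theorem IsNice.apply_coord {op : MSE n R → MSE n R → MSE n R} (hop : IsNice op) (i : Fin n)
    (v w : Um n R) (h : ∀ j, j ≠ i → w.1 j = v.1 j) :
    ∃ hu : IsUnimodular (Function.update v.1 i (v.1 i * w.1 i)),
      op (MSE.mk w) (MSE.mk v) = MSE.mk ⟨Function.update v.1 i (v.1 i * w.1 i), hu⟩ := by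
  by_cases hi : i = 0
  · subst hi; exact hop v w h
  obtain ⟨g, hg, hsw⟩ := exists_elem_vecMul_eq_swap (R := R) hi
  let s : Um n R → Um n R := fun v => ⟨v.1 ᵥ* (g : Matrix (Fin n) (Fin n) R), v.2.vecMul g⟩
  have hs : ∀ v, MSE.mk (s v) = MSE.mk v := fun v => (MSE.mk_eq_iff.2 ⟨g, hg, rfl⟩).symm
  obtain ⟨hu, h1⟩ := hop (s v) (s w) (by
    intro j hj
    show (w.1 ᵥ* (g : Matrix (Fin n) (Fin n) R)) j = (v.1 ᵥ* (g : Matrix (Fin n) (Fin n) R)) j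
    rw [hsw, hsw]
    by_cases hji : j = i
    · subst hji; simp [hj, h 0 (Ne.symm hi)]
    · simp [hj, hji, h j hji])
  have h2 : Function.update (s v).1 0 ((s v).1 0 * (s w).1 0) =
      Function.update v.1 i (v.1 i * w.1 i) ᵥ* (g : Matrix (Fin n) (Fin n) R) := by
    show Function.update (v.1 ᵥ* (g : Matrix (Fin n) (Fin n) R)) 0
      ((v.1 ᵥ* (g : Matrix (Fin n) (Fin n) R)) 0 * (w.1 ᵥ* (g : Matrix (Fin n) (Fin n) R)) 0) = _
    rw [hsw, hsw, hsw]
    ext j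
    by_cases hj : j = 0
    · subst hj; simp
    · by_cases hji : j = i
      · subst hji; simp [hj, Ne.symm hj]
      · simp [hj, hji]
  have hu' : IsUnimodular (Function.update v.1 i (v.1 i * w.1 i)) := by
    have := hu.vecMul g⁻¹
    rw [h2, vecMul_vecMul, ← Units.val_mul, mul_inv_cancel] at this
    simpa using this
  refine ⟨hu', ?_⟩
  rw [hs, hs] at h1
  rw [h1]
  exact (MSE.mk_eq_iff.2 ⟨g, hg, h2.symm⟩).symm

/-- The entry can be replaced by 1; as 1 · 1 = 1, niceness makes the class idempotent. -/
theorem MSE.mk_eq_one_of_mem_span (hn : 3 ≤ n) [Group (MSE n R)]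
    (hnice : IsNice (fun x y : MSE n R => x * y)) (i : Fin n) (v : Um n R)
    (hv : v.1 i - 1 ∈ Ideal.span {x | ∃ j, j ≠ i ∧ x = v.1 j}) : MSE.mk v = 1 := by
  have e : RowEquiv ⊤ v.1 (Function.update v.1 i 1) := by
    have := rowEquiv_update_of_mem_span (I := ⊤) hn i v.1 (neg_mem hv) (m := 1) trivial
    simpa using this
  let q : Um n R := ⟨Function.update v.1 i 1, e.isUnimodular v.2⟩
  have hq : MSE.mk v = MSE.mk q := MSE.mk_eq_of_rowEquiv e
  obtain ⟨hu, h⟩ := hnice.apply_coord i q q (fun _ _ => rfl)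
  have : MSE.mk q * MSE.mk q = MSE.mk q := by
    refine h.trans (congrArg MSE.mk (Subtype.ext ?_))
    simp [q]
  rw [hq]
  exact mul_eq_left.1 this

end NiceAbsolute

/-! ### Transfer of niceness along φ -/

section NiceRelative

variable {n : ℕ} [NeZero n] {R : Type*} [CommRing R] {I : Ideal R}
  [Group (MSE n (ExcisionRing I))]

theorem MSERel.exists_toExcision_mul_eq (hn : 3 ≤ n)
    (hnice : IsNice (fun x y : MSE n (ExcisionRing I) => x * y)) (i : Fin n)
    (v w : UmRel n R I) (h : ∀ j, j ≠ i → w.1 j = v.1 j) :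
    ∃ u : UmRel n R I, u.1 = Function.update v.1 i (v.1 i * w.1 i) ∧
      (UmRel.lift u).1 = Function.update (UmRel.lift v).1 i
        ((UmRel.lift v).1 i * (UmRel.lift w).1 i) ∧
      MSERel.toExcision hn (MSERel.mk w) * MSERel.toExcision hn (MSERel.mk v) =
        MSERel.toExcision hn (MSERel.mk u) := by
  obtain ⟨hu, h1⟩ := hnice.apply_coord i (UmRel.lift v) (UmRel.lift w) (fun j hj =>
    ExcisionRing.ext_of_aug (by rw [UmRel.aug_lift, UmRel.aug_lift])
      (by rw [UmRel.toRing_lift, UmRel.toRing_lift, h j hj]))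
  have hmap : ∀ {S : Type _} [CommRing S] (f : ExcisionRing I →+* S),
      (fun j => f (Function.update (UmRel.lift v).1 i
        ((UmRel.lift v).1 i * (UmRel.lift w).1 i) j)) =
      Function.update (fun j => f ((UmRel.lift v).1 j)) i
        (f ((UmRel.lift v).1 i) * f ((UmRel.lift w).1 i)) := by
    intro S _ f
    ext j
    by_cases hj : j = i
    · subst hj; simp
    · simp [hj]
  have hR := hmap (ExcisionRing.toRing I)
  rw [funext (UmRel.toRing_lift v), UmRel.toRing_lift v, UmRel.toRing_lift w] at hR
  have hum := hu.map (ExcisionRing.toRing I)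
  rw [hR] at hum
  let u : UmRel n R I := ⟨_, hum, (UmRel.isRelRow v).update_mul (UmRel.isRelRow w) i⟩
  have hlift : Function.update (UmRel.lift v).1 i
      ((UmRel.lift v).1 i * (UmRel.lift w).1 i) = (UmRel.lift u).1 := by
    refine UmRel.eq_lift ?_ hR
    rw [hmap, funext (UmRel.aug_lift v), UmRel.aug_lift v, UmRel.aug_lift w]
    ext j
    by_cases hj : j = i
    · subst hj
      by_cases h0 : j = 0
      · subst h0; simp
      · simp [h0]
    · simp [hj]
  refine ⟨u, rfl, hlift.symm, h1.trans ?_⟩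
  rw [MSERel.toExcision_mk]
  exact congrArg MSE.mk (Subtype.ext hlift)

theorem MSERel.toExcision_mk_base (hn : 3 ≤ n)
    (hnice : IsNice (fun x y : MSE n (ExcisionRing I) => x * y)) :
    MSERel.toExcision hn (MSERel.mk (UmRel.base n I)) = 1 := by
  rw [MSERel.toExcision_mk]
  exact MSE.mk_eq_one_of_mem_span hn hnice 0 _ (by simp [UmRel.lift_base])

variable [Group (MSERel n R I)]

theorem MSERel.toExcision_mk_mul_mk_of_common_tail (hn : 3 ≤ n)
    (hrel : IsVvRuleRel (fun x y : MSERel n R I => x * y))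
    (habs : IsVvRule (fun x y : MSE n (ExcisionRing I) => x * y)) {i : Fin n} (hi : i ≠ 0)
    (v w : UmRel n R I) (h : ∀ j, j ≠ 0 → j ≠ i → w.1 j = v.1 j) {σ : R}
    (hσ : w.1 i * σ - 1 ∈ Ideal.span {x | ∃ j, j ≠ i ∧ x = v.1 j}) :
    MSERel.toExcision hn (MSERel.mk w * MSERel.mk v) =
      MSERel.toExcision hn (MSERel.mk w) * MSERel.toExcision hn (MSERel.mk v) := by
  obtain ⟨t, v', w', hv', hw', hagree, -⟩ := exists_common_tail hn hi v w h hσ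
  obtain ⟨p, u, -, h1, h2⟩ := MSERel.exists_mk_mul_mk hn hrel habs v' w' hagree
  rw [← hv', ← hw', h1, h2]

theorem MSERel.toExcision_mk_mul_mk (hn : 3 ≤ n)
    (hrel : IsVvRuleRel (fun x y : MSERel n R I => x * y))
    (habs : IsVvRule (fun x y : MSE n (ExcisionRing I) => x * y)) (i : Fin n)
    (v w : UmRel n R I) (h : ∀ j, j ≠ i → w.1 j = v.1 j) :
    MSERel.toExcision hn (MSERel.mk w * MSERel.mk v) =
      MSERel.toExcision hn (MSERel.mk w) * MSERel.toExcision hn (MSERel.mk v) := by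
  by_cases hi : i = 0
  · subst hi
    obtain ⟨p, u, -, h1, h2⟩ := MSERel.exists_mk_mul_mk hn hrel habs v w h
    rw [h1, h2]
  · obtain ⟨d, hd⟩ := w.2.1
    have hσ := mul_sub_one_mem_span hd i
    rw [span_others_congr h] at hσ
    exact MSERel.toExcision_mk_mul_mk_of_common_tail hn hrel habs hi v w
      (fun j _ hj => h j hj) hσ

/-- φ sends both the base point and its square to 1, so by triviality of the kernel the base point
is idempotent. -/
theorem MSERel.mk_base_eq_one (hn : 3 ≤ n)
    (hrel : IsVvRuleRel (fun x y : MSERel n R I => x * y))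
    (habs : IsVvRule (fun x y : MSE n (ExcisionRing I) => x * y))
    (hnice : IsNice (fun x y : MSE n (ExcisionRing I) => x * y)) :
    MSERel.mk (UmRel.base n I) = 1 := by
  have h := MSERel.toExcision_mk_mul_mk hn hrel habs 0 (UmRel.base n I) (UmRel.base n I)
    (fun _ _ => rfl)
  rw [MSERel.toExcision_mk_base hn hnice, mul_one, ← MSERel.toExcision_mk_base hn hnice] at h
  exact mul_eq_left.1 (MSERel.eq_base_of_toExcision_eq hn h)

theorem MSERel.toExcision_eq_one_iff (hn : 3 ≤ n)
    (hrel : IsVvRuleRel (fun x y : MSERel n R I => x * y))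
    (habs : IsVvRule (fun x y : MSE n (ExcisionRing I) => x * y))
    (hnice : IsNice (fun x y : MSE n (ExcisionRing I) => x * y)) {x : MSERel n R I} :
    MSERel.toExcision hn x = 1 ↔ x = 1 := by
  rw [← MSERel.mk_base_eq_one hn hrel habs hnice, ← MSERel.toExcision_mk_base hn hnice]
  exact ⟨MSERel.eq_base_of_toExcision_eq hn, fun h => congrArg _ h⟩

/-- The inverse of a class is obtained by inverting one entry modulo the others. -/
theorem MSERel.exists_update_mul_eq_one (hn : 3 ≤ n)
    (hrel : IsVvRuleRel (fun x y : MSERel n R I => x * y))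
    (habs : IsVvRule (fun x y : MSE n (ExcisionRing I) => x * y))
    (hnice : IsNice (fun x y : MSE n (ExcisionRing I) => x * y)) (i : Fin n) (v : UmRel n R I) :
    ∃ (s : R) (w : UmRel n R I), w.1 = Function.update v.1 i s ∧
      MSERel.mk w * MSERel.mk v = 1 := by
  have hv := UmRel.isRelRow v
  obtain ⟨d, hd, hdr⟩ := v.2.1.exists_dual_isRelRow v.2.2.1
  have hw : IsUnimodular (Function.update v.1 i (d i)) := by
    -- Exchanging v_i and d_i does not change the pairing.
    refine ⟨Function.update d i (v.1 i), ?_⟩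
    refine Eq.trans ?_ hd
    refine Finset.sum_congr rfl fun j _ => ?_
    by_cases hj : j = i
    · subst hj; simp [mul_comm]
    · simp [hj]
  let w : UmRel n R I := ⟨Function.update v.1 i (d i), hw, hv.update hdr i⟩
  have hagree : ∀ j, j ≠ i → w.1 j = v.1 j := fun j hj => by simp [w, hj]
  refine ⟨d i, w, rfl, ?_⟩
  rw [← MSERel.toExcision_eq_one_iff hn hrel habs hnice,
    MSERel.toExcision_mk_mul_mk hn hrel habs i v w hagree]
  obtain ⟨u, -, hul, hu⟩ := MSERel.exists_toExcision_mul_eq hn hnice i v w hagree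
  rw [hu, MSERel.toExcision_mk]
  -- The product entry v_i d_i is 1 modulo the other entries, also after lifting, so the product has
  -- image 1 under φ.
  refine MSE.mk_eq_one_of_mem_span hn hnice i _ ?_
  rw [span_others_congr (v := (UmRel.lift v).1) (fun j hj => by rw [hul]; simp [hj]), hul,
    Function.update_self]
  have hwi : (UmRel.lift w).1 i = IntExcisionRing.toExcision I (hdr.lift i) := by
    refine congrArg (IntExcisionRing.toExcision I) (IntExcisionRing.ext_of_aug ?_ ?_)
    · rw [IsRelRow.aug_lift, IsRelRow.aug_lift]
    · rw [IsRelRow.toRing_lift, IsRelRow.toRing_lift]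
      simp [w]
  rw [hwi]
  refine mul_sub_one_mem_span
    (w := fun j => IntExcisionRing.toExcision I (hdr.lift j)) ?_ i
  have := congrArg (IntExcisionRing.toExcision I) (hv.lift_dotProduct hdr hd)
  rw [map_one] at this
  rw [← this, dotProduct, dotProduct, map_sum]
  simp [UmRel.lift]

theorem MSERel.mk_mul_mk_zero (hn : 3 ≤ n)
    (hrel : IsVvRuleRel (fun x y : MSERel n R I => x * y))
    (habs : IsVvRule (fun x y : MSE n (ExcisionRing I) => x * y))
    (hnice : IsNice (fun x y : MSE n (ExcisionRing I) => x * y))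
    (v w : UmRel n R I) (h : ∀ j, j ≠ 0 → w.1 j = v.1 j) :
    ∃ u : UmRel n R I, u.1 = Function.update v.1 0 (v.1 0 * w.1 0) ∧
      MSERel.mk w * MSERel.mk v = MSERel.mk u := by
  have h10 := one_ne_zero_fin hn
  obtain ⟨p, r, hr, hmul, hφr⟩ := MSERel.exists_mk_mul_mk hn hrel habs v w h
  obtain ⟨u, hu, -, hφu⟩ := MSERel.exists_toExcision_mul_eq hn hnice 0 v w h
  obtain ⟨s, c, hc, hcu⟩ := MSERel.exists_update_mul_eq_one hn hrel habs hnice 0 u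
  refine ⟨u, hu, hmul.trans ?_⟩
  have hφc := MSERel.toExcision_mk_mul_mk hn hrel habs 0 u c (fun j hj => by simp [hc, hj])
  rw [hcu, (MSERel.toExcision_eq_one_iff hn hrel habs hnice).2 rfl] at hφc
  obtain ⟨e, he⟩ := r.2.1
  have hσ := mul_sub_one_mem_span he 1
  -- The entry 1 of r is v₁ (w₀ + p) and that of c is v₁. A row unimodular with the former shows v₁
  -- to be invertible modulo the other entries of r, as `exists_common_tail` requires.
  rw [show r.1 1 * e 1 = c.1 1 * ((w.1 0 + p) * e 1) by
    simp [hr, hc, hu, vvRow, h10, mul_assoc]] at hσ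
  have hφ := MSERel.toExcision_mk_mul_mk_of_common_tail hn hrel habs h10 r c
    (fun j hj hj1 => by simp [hr, hc, hu, vvRow, hj, hj1]) hσ
  rw [hφr, hφu, ← hφc, MSERel.toExcision_eq_one_iff hn hrel habs hnice, ← hcu] at hφ
  exact mul_left_cancel hφ

end NiceRelative

/-- For i ≠ 0 the rows v, w are first moved to rows with common tails, whose product r is known from
niceness in coordinate 0. Then r and the inverse c of u differ only in coordinates 0 and i, and the
cancellation argument applies again. -/
theorem mainTheorem5 (n : ℕ) [NeZero n] (hn : 3 ≤ n) {R : Type*} [CommRing R] (I : Ideal R)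
    [Group (MSERel n R I)] [Group (MSE n (ExcisionRing I))]
    (hrel : IsVvRuleRel (fun x y : MSERel n R I => x * y))
    (habs : IsVvRule (fun x y : MSE n (ExcisionRing I) => x * y))
    (hnice : IsNice (fun x y : MSE n (ExcisionRing I) => x * y)) :
    IsNiceRel (fun x y : MSERel n R I => x * y) := by
  intro i v w h
  by_cases hi : i = 0
  · subst hi
    exact MSERel.mk_mul_mk_zero hn hrel habs hnice v w h
  obtain ⟨u, hu, -, hφu⟩ := MSERel.exists_toExcision_mul_eq hn hnice i v w h
  obtain ⟨s, c, hc, hcu⟩ := MSERel.exists_update_mul_eq_one hn hrel habs hnice i u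
  have huc : MSERel.mk u * MSERel.mk c = 1 := mul_eq_one_comm.1 hcu
  obtain ⟨d, hd⟩ := w.2.1
  have hσ := mul_sub_one_mem_span hd i
  rw [span_others_congr h] at hσ
  obtain ⟨t, v', w', hv', hw', hagree, hvt⟩ :=
    exists_common_tail hn hi v w (fun j _ hj => h j hj) hσ
  obtain ⟨r, hr, hmul⟩ := MSERel.mk_mul_mk_zero hn hrel habs hnice v' w' hagree
  have hφw := MSERel.toExcision_mk_mul_mk hn hrel habs i v w h
  rw [← hv', ← hw', hmul, hv', hw', hφu] at hφw
  refine ⟨u, hu, ?_⟩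
  show MSERel.mk w * MSERel.mk v = MSERel.mk u
  rw [← hv', ← hw', hmul]
  have hφc := MSERel.toExcision_mk_mul_mk hn hrel habs i c u (fun j hj => by simp [hc, hj])
  rw [huc, (MSERel.toExcision_eq_one_iff hn hrel habs hnice).2 rfl] at hφc
  -- Here it is the i-th entry t of r that is invertible modulo the other entries of c, which are
  -- those of v'. This puts c on the right, hence the use of [u] * [c] = 1.
  obtain ⟨e, he⟩ := v'.2.1
  have hσ' := mul_sub_one_mem_span he i
  rw [span_others_congr (v := c.1) (fun j hj => by simp [hvt, hc, hu, hj]),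
    show v'.1 i = r.1 i by simp [hr, hi]] at hσ'
  have hφ := MSERel.toExcision_mk_mul_mk_of_common_tail hn hrel habs hi c r
    (fun j hj hji => by simp [hr, hvt, hc, hu, hj, hji]) hσ'
  rw [hφw, ← hφc, MSERel.toExcision_eq_one_iff hn hrel habs hnice, ← huc] at hφ
  exact mul_right_cancel hφ
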